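/- **Theorem (completeness of connections).** All manifolds are smooth, finite-dimensional, Hausdorff, second countable and without boundary. Let $\mathscr{G}\rightrightarrows M$ be a Lie groupoid with source $s$ and target $t$ (surjective submersions; $g.h$ is defined when $s(g)=t(h)$). For $g\in\mathscr{G}$ write $r_g\colon s^{-1}(t(g))\to s^{-1}(s(g))$, $h\mapsto h.g$. A *right-invariant vector field* is a smooth section $V$ of $\ker Ts$ with $T_hr_g(V(h))=V(h.g)$ whenever $s(h)=t(g)$. Let $\mathscr{P}$ be a principaloid $\mathscr{G}$-bundle over a manifold $\Sigma$: a surjective submersion $\pi\colon\mathscr{P}\to\Sigma$ with a smooth map $\mu\colon\mathscr{P}\to M$ and a smooth right action $\varrho_g(p)=p\blacktriangleleft g$ of $\mathscr{G}$ along $\mu$ (defined when $\mu(p)=t(g)$; $\mu(p\blacktriangleleft g)=s(g)$, $p\blacktriangleleft \mathrm{Id}_{\mu(p)}=p$, $(p\blacktriangleleft g)\blacktriangleleft h=p\blacktriangleleft(g.h)$) preserving the $\pi$-fibres, such that $\Sigma$ is covered by open sets $O$ admitting $\mathscr{G}$-equivariant diffeomorphisms $\pi^{-1}(O)\cong O\times\mathscr{G}$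 over $O$, where on $O\times\mathscr{G}$ the moment map is $(\sigma,g)\mapsto s(g)$ and $\mathscr{G}$ acts by right multiplication. Its *shadow* $\mathscr{F}\to\Sigma$ is the fibre bundle with typical fibre $M$ glued from the products $O\times M$ by the maps $m\mapsto t(\beta(\sigma)(m))$, where $(\sigma,g)\mapsto(\sigma,\beta(\sigma)(t(g)).g)$ are the transition maps of $\mathscr{P}$; let $\mathscr{D}\colon\mathscr{P}\to\mathscr{F}$ be the map given by $(\sigma,g)\mapsto(\sigma,t(g))$ in corresponding trivialisations. A *connection 1-form* on $\mathscr{P}$ is a smooth field $\Theta$ of endomorphisms of $T\mathscr{P}$ with values in $V\mathscr{P}=\ker T\pi$, equal to the identity on $V\mathscr{P}$, with $T\mu\circ\Theta=T\mu$ and $T_p\varrho_g(\ker\Theta_p)=\ker\Theta_{p\blacktriangleleft g}$ whenever $\mu(p)=t(g)$. Its horizontal distribution is $\ker\Theta$; the induced *shadow connection* on $\mathscr{F}$ has horizontal distribution $T\mathscr{D}(\ker\Theta)$. A connection on a fibre bundle over $\Sigma$ is *complete* if every smooth curve in $\Sigma$ defined on an open interval $J$ has, through every point of the fibre over any of its points,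 a smooth horizontal lift defined on all of $J$. 1. Let $\Theta$ be a connection 1-form on $\mathscr{P}$. Suppose that the manifold $\mathscr{G}$ has a complete Riemannian metric for which every right-invariant vector field is bounded on $t^{-1}(K)$ for every compact $K\subset M$ (in particular, this holds if right-invariant vector fields are bounded on $\mathscr{G}$), and that the shadow connection on $\mathscr{F}$ induced by $\Theta$ is complete. Then $\Theta$ is complete. 2. Suppose that $M$ is compact and that $\mathscr{G}$ has a complete $\mathscr{G}$-invariant Riemannian metric, that is, a complete metric such that either all right translations $r_g\colon s^{-1}(t(g))\to s^{-1}(s(g))$ are isometries for the induced metrics, or the inversion of $\mathscr{G}$ is an isometry and $t$ is a Riemannian submersion for some Riemannian metric on $M$. Then every connection 1-form on $\mathscr{P}$ is complete. -/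

import Mathlib

open Set Filter Topology Manifold Bundle
open scoped ContDiff ENNReal

noncomputable section

/-! ## Lie groupoids

All manifolds are modelled on `𝓘(ℝ, E)` for a real normed space `E` (finite dimensional in the
theorem), hence have no boundary.  Partially defined maps (multiplication, actions) are total
functions whose values outside their domain carry no meaning; smoothness on a fibre product, which
is an embedded submanifold of the product, is smoothness on that subset of the ambient product. -/

/-- A Lie groupoid with arrow manifold `G` and object manifold `M`; `mul g h` is the product `g.h`,
meaningful when `s g = t h`. -/
structure LieGroupoid (EM EG M G : Type*)
    [NormedAddCommGroup EM] [NormedSpace ℝ EM] [NormedAddCommGroup EG] [NormedSpace ℝ EG]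
    [TopologicalSpace M] [ChartedSpace EM M] [TopologicalSpace G] [ChartedSpace EG G] where
  /-- source -/
  s : G → M
  /-- target -/
  t : G → M
  /-- unit arrows -/
  one : M → G
  /-- inverse -/
  inv : G → G
  /-- multiplication -/
  mul : G → G → G
  s_one : ∀ m, s (one m) = m
  t_one : ∀ m, t (one m) = m
  s_mul : ∀ g h, s g = t h → s (mul g h) = s h
  t_mul : ∀ g h, s g = t h → t (mul g h) = t g
  mul_assoc : ∀ g h k, s g = t h → s h = t k → mul (mul g h) k = mul g (mul h k)
  one_mul : ∀ g, mul (one (t g)) g = g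
  mul_one : ∀ g, mul g (one (s g)) = g
  s_inv : ∀ g, s (inv g) = t g
  t_inv : ∀ g, t (inv g) = s g
  mul_inv : ∀ g, mul g (inv g) = one (t g)
  inv_mul : ∀ g, mul (inv g) g = one (s g)
  submersion_s : Manifold.IsSubmersion 𝓘(ℝ, EG) 𝓘(ℝ, EM) ∞ s
  submersion_t : Manifold.IsSubmersion 𝓘(ℝ, EG) 𝓘(ℝ, EM) ∞ t
  smooth_one : ContMDiff 𝓘(ℝ, EM) 𝓘(ℝ, EG) ∞ one
  smooth_inv : ContMDiff 𝓘(ℝ, EG) 𝓘(ℝ, EG) ∞ inv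
  smooth_mul : ContMDiffOn (𝓘(ℝ, EG).prod 𝓘(ℝ, EG)) 𝓘(ℝ, EG) ∞
    (fun p : G × G => mul p.1 p.2) {p : G × G | s p.1 = t p.2}

section Groupoid

variable {EM EG M G : Type*}
  [NormedAddCommGroup EM] [NormedSpace ℝ EM] [NormedAddCommGroup EG] [NormedSpace ℝ EG]
  [TopologicalSpace M] [ChartedSpace EM M] [TopologicalSpace G] [ChartedSpace EG G]

namespace LieGroupoid

variable (Γ : LieGroupoid EM EG M G)

/-- The tangent map `T_h r_g` of the right translation `r_g : s⁻¹(t(g)) → s⁻¹(s(g))`, `h ↦ h.g`.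
Only its values on vectors of `ker T_h s`, the tangent space of the `s`-fibre, are meaningful (and
these do not depend on how the derivative within the fibre is extended to other vectors). -/
def tangentRight (g h : G) :
    TangentSpace 𝓘(ℝ, EG) h →L[ℝ] TangentSpace 𝓘(ℝ, EG) (Γ.mul h g) :=
  mfderivWithin 𝓘(ℝ, EG) 𝓘(ℝ, EG) (fun k => Γ.mul k g) {k | Γ.s k = Γ.t g} h

/-- Right-invariant vector fields on `G`: smooth sections of `ker T s` with
`T_h r_g (V h) = V (h.g)` whenever `s h = t g`. -/
structure IsRightInvariantField [IsManifold 𝓘(ℝ, EG) ∞ G]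
    (V : ∀ g : G, TangentSpace 𝓘(ℝ, EG) g) : Prop where
  smooth : ContMDiff 𝓘(ℝ, EG) 𝓘(ℝ, EG).tangent ∞
    (fun g => (⟨g, V g⟩ : TangentBundle 𝓘(ℝ, EG) G))
  tangent_fibre : ∀ g, mfderiv 𝓘(ℝ, EG) 𝓘(ℝ, EM) Γ.s g (V g) = 0
  invariant : ∀ g h, Γ.s h = Γ.t g → Γ.tangentRight g h (V h) = V (Γ.mul h g)

end LieGroupoid

/-! ## Riemannian metrics -/

/-- Smooth Riemannian metrics on a manifold `X`. -/
abbrev SmoothMetric (E X : Type*) [NormedAddCommGroup E] [NormedSpace ℝ E]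
    [TopologicalSpace X] [ChartedSpace E X] [IsManifold 𝓘(ℝ, E) ∞ X] : Type _ :=
  Bundle.ContMDiffRiemannianMetric 𝓘(ℝ, E) ∞ E (fun x : X => TangentSpace 𝓘(ℝ, E) x)

section Metric

variable {E X : Type*} [NormedAddCommGroup E] [NormedSpace ℝ E]
  [TopologicalSpace X] [ChartedSpace E X] [IsManifold 𝓘(ℝ, E) ∞ X]

/-- The Riemannian distance of a metric: the infimum of the lengths of connecting paths
(infinite between points of different components). -/
def SmoothMetric.dist (η : SmoothMetric E X) (x y : X) : ℝ≥0∞ :=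
  letI : Bundle.RiemannianBundle (fun x : X => TangentSpace 𝓘(ℝ, E) x) := ⟨η.toRiemannianMetric⟩
  Manifold.riemannianEDist 𝓘(ℝ, E) x y

/-- A Riemannian metric is complete if every sequence that is Cauchy for its Riemannian distance
converges. -/
def SmoothMetric.IsComplete (η : SmoothMetric E X) : Prop :=
  ∀ u : ℕ → X, (∀ ε : ℝ≥0∞, 0 < ε → ∃ N, ∀ m, N ≤ m → ∀ n, N ≤ n → η.dist (u m) (u n) < ε) →
    ∃ x, Tendsto u atTop (𝓝 x)

end Metric

namespace LieGroupoid

variable (Γ : LieGroupoid EM EG M G) [IsManifold 𝓘(ℝ, EG) ∞ G]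

/-- Right-invariant vector fields are bounded for the metric `η`: each has bounded norm on
`t⁻¹(K)`, for every compact set `K` of objects.  (When `M` is compact this is boundedness on
`G`; in general, it follows from boundedness on `G`.) -/
def RightInvariantFieldsBounded (η : SmoothMetric EG G) : Prop :=
  ∀ V : (∀ g : G, TangentSpace 𝓘(ℝ, EG) g), Γ.IsRightInvariantField V →
    ∀ K : Set M, IsCompact K → ∃ C : ℝ, ∀ g, Γ.t g ∈ K → √(η.inner g (V g) (V g)) ≤ C

/-- All right translations `r_g : s⁻¹(t(g)) → s⁻¹(s(g))` are isometries for the metrics induced on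
the `s`-fibres. -/
def IsRightInvariantMetric (η : SmoothMetric EG G) : Prop :=
  ∀ g h, Γ.s h = Γ.t g → ∀ v w : TangentSpace 𝓘(ℝ, EG) h,
    mfderiv 𝓘(ℝ, EG) 𝓘(ℝ, EM) Γ.s h v = 0 → mfderiv 𝓘(ℝ, EG) 𝓘(ℝ, EM) Γ.s h w = 0 →
    η.inner (Γ.mul h g) (Γ.tangentRight g h v) (Γ.tangentRight g h w) = η.inner h v w

/-- Metrics on the arrow manifold of a Riemannian groupoid: the inversion is an isometry, and the
target map is a Riemannian submersion for some metric on `M` (hence so is the source map). -/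
def IsGroupoidMetric [IsManifold 𝓘(ℝ, EM) ∞ M] (η : SmoothMetric EG G) : Prop :=
  (∀ (g : G) (v w : TangentSpace 𝓘(ℝ, EG) g),
    η.inner (Γ.inv g) (mfderiv 𝓘(ℝ, EG) 𝓘(ℝ, EG) Γ.inv g v)
      (mfderiv 𝓘(ℝ, EG) 𝓘(ℝ, EG) Γ.inv g w) = η.inner g v w) ∧
  ∃ ηM : SmoothMetric EM M, ∀ (g : G) (v w : TangentSpace 𝓘(ℝ, EG) g),
    (∀ u : TangentSpace 𝓘(ℝ, EG) g,
      mfderiv 𝓘(ℝ, EG) 𝓘(ℝ, EM) Γ.t g u = 0 → η.inner g v u = 0 ∧ η.inner g w u = 0) →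
    ηM.inner (Γ.t g) (mfderiv 𝓘(ℝ, EG) 𝓘(ℝ, EM) Γ.t g v)
      (mfderiv 𝓘(ℝ, EG) 𝓘(ℝ, EM) Γ.t g w) = η.inner g v w

/-- `G`-invariant metrics, in either sense: invariant under right translations along the
`s`-fibres, or compatible with the groupoid structure as for Riemannian groupoids. -/
def IsInvariantMetric [IsManifold 𝓘(ℝ, EM) ∞ M] (η : SmoothMetric EG G) : Prop :=
  Γ.IsRightInvariantMetric η ∨ Γ.IsGroupoidMetric η

end LieGroupoid

end Groupoid

/-! ## Complete connections on fibre bundles -/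

section Complete

variable {EB EX B X : Type*}
  [NormedAddCommGroup EB] [NormedSpace ℝ EB] [TopologicalSpace B] [ChartedSpace EB B]
  [NormedAddCommGroup EX] [NormedSpace ℝ EX] [TopologicalSpace X] {HX : Type*}
  [TopologicalSpace HX] [ChartedSpace HX X]

/-- A horizontal distribution `H ⊆ T X` over `proj : X → B` (given as the set of horizontal tangent
vectors) is complete if every smooth curve in `B`, defined on an open interval `J`, has through
each point of `X` over the curve a smooth horizontal lift defined on all of `J`. -/
def IsCompleteDistribution (IX : ModelWithCorners ℝ EX HX) (proj : X → B)
    (H : Set (TangentBundle IX X)) : Prop :=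
  ∀ (J : Set ℝ) (γ : ℝ → B), IsOpen J → J.OrdConnected →
    ContMDiffOn 𝓘(ℝ, ℝ) 𝓘(ℝ, EB) ∞ γ J →
    ∀ t₀ ∈ J, ∀ x₀ : X, proj x₀ = γ t₀ →
      ∃ c : ℝ → X, ContMDiffOn 𝓘(ℝ, ℝ) IX ∞ c J ∧ c t₀ = x₀ ∧
        ∀ t ∈ J, proj (c t) = γ t ∧
          (⟨c t, mfderiv 𝓘(ℝ, ℝ) IX c t (1 : ℝ)⟩ : TangentBundle IX X) ∈ H

end Complete

/-! ## Principaloid bundles -/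

section Principaloid

variable {EM EG EB EP M G B P : Type*}
  [NormedAddCommGroup EM] [NormedSpace ℝ EM] [NormedAddCommGroup EG] [NormedSpace ℝ EG]
  [NormedAddCommGroup EB] [NormedSpace ℝ EB] [NormedAddCommGroup EP] [NormedSpace ℝ EP]
  [TopologicalSpace M] [ChartedSpace EM M] [TopologicalSpace G] [ChartedSpace EG G]
  [TopologicalSpace B] [ChartedSpace EB B] [TopologicalSpace P] [ChartedSpace EP P]

/-- A `G`-equivariant local trivialisation `proj⁻¹(O) ≅ O × G`, `p ↦ (proj p, pr₂(τ p))`, of `proj : P → B`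
with moment map `μ` and (partial) right action `act`. -/
structure LocalTrivialisation (Γ : LieGroupoid EM EG M G) (EB EP : Type*)
    [NormedAddCommGroup EB] [NormedSpace ℝ EB] [NormedAddCommGroup EP] [NormedSpace ℝ EP]
    {B P : Type*} [TopologicalSpace B] [ChartedSpace EB B] [TopologicalSpace P] [ChartedSpace EP P]
    (proj : P → B) (μ : P → M) (act : P → G → P) where
  /-- the domain in the base -/
  O : Set B
  isOpen_O : IsOpen O
  /-- the trivialisation -/
  τ : OpenPartialHomeomorph P (B × G)
  source_eq : τ.source = proj ⁻¹' O
  target_eq : τ.target = O ×ˢ univ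
  smooth : ContMDiffOn 𝓘(ℝ, EP) (𝓘(ℝ, EB).prod 𝓘(ℝ, EG)) ∞ τ τ.source
  smooth_symm : ContMDiffOn (𝓘(ℝ, EB).prod 𝓘(ℝ, EG)) 𝓘(ℝ, EP) ∞ τ.symm τ.target
  fst_apply : ∀ p, proj p ∈ O → (τ p).1 = proj p
  s_apply : ∀ p, proj p ∈ O → Γ.s (τ p).2 = μ p
  act_apply : ∀ p g, proj p ∈ O → μ p = Γ.t g → τ (act p g) = (proj p, Γ.mul (τ p).2 g)

/-- A principaloid `G`-bundle with base `B` and total space `P`: a fibre bundle with typical fibre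
`G`, with a fibre-preserving right action of the groupoid along a moment map `μ` (`act p g` is
meaningful when `μ p = t g`), and with `G`-equivariant local trivialisations. -/
structure PrincipaloidBundle (Γ : LieGroupoid EM EG M G) (EB EP B P : Type*)
    [NormedAddCommGroup EB] [NormedSpace ℝ EB] [NormedAddCommGroup EP] [NormedSpace ℝ EP]
    [TopologicalSpace B] [ChartedSpace EB B] [TopologicalSpace P] [ChartedSpace EP P] where
  /-- bundle projection -/
  proj : P → B
  /-- moment map -/
  μ : P → M
  /-- right action -/
  act : P → G → P
  surjective_proj : Function.Surjective proj
  submersion_proj : Manifold.IsSubmersion 𝓘(ℝ, EP) 𝓘(ℝ, EB) ∞ proj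
  smooth_μ : ContMDiff 𝓘(ℝ, EP) 𝓘(ℝ, EM) ∞ μ
  smooth_act : ContMDiffOn (𝓘(ℝ, EP).prod 𝓘(ℝ, EG)) 𝓘(ℝ, EP) ∞
    (fun q : P × G => act q.1 q.2) {q : P × G | μ q.1 = Γ.t q.2}
  proj_act : ∀ p g, μ p = Γ.t g → proj (act p g) = proj p
  μ_act : ∀ p g, μ p = Γ.t g → μ (act p g) = Γ.s g
  act_one : ∀ p, act p (Γ.one (μ p)) = p
  act_act : ∀ p g h, μ p = Γ.t g → Γ.s g = Γ.t h → act (act p g) h = act p (Γ.mul g h)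
  locally_trivial : ∀ b : B, ∃ T : LocalTrivialisation Γ EB EP proj μ act, b ∈ T.O

namespace PrincipaloidBundle

variable {Γ : LieGroupoid EM EG M G} (𝓑 : PrincipaloidBundle Γ EB EP B P)

/-- The tangent map `T_p ϱ_g` of `ϱ_g : μ⁻¹(t(g)) → μ⁻¹(s(g))`, `p ↦ act p g`.  Only its values on
vectors of `ker T_p μ`, the tangent space of the `μ`-fibre, are meaningful. -/
def tangentAct (g : G) (p : P) :
    TangentSpace 𝓘(ℝ, EP) p →L[ℝ] TangentSpace 𝓘(ℝ, EP) (𝓑.act p g) :=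
  mfderivWithin 𝓘(ℝ, EP) 𝓘(ℝ, EP) (fun q => 𝓑.act q g) {q | 𝓑.μ q = Γ.t g} p

/-- Compatible connection 1-forms: smooth endomorphism fields of `T P` with values in the vertical
bundle `ker T proj`, equal to the identity on it, with `T μ ∘ Θ = T μ` and with kernel invariant under
the groupoid action. -/
structure ConnectionForm [IsManifold 𝓘(ℝ, EP) ∞ P] where
  /-- the endomorphism field -/
  Θ : ∀ p : P, TangentSpace 𝓘(ℝ, EP) p →L[ℝ] TangentSpace 𝓘(ℝ, EP) p
  smooth : ContMDiff 𝓘(ℝ, EP) (𝓘(ℝ, EP).prod 𝓘(ℝ, EP →L[ℝ] EP)) ∞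
    (fun p => TotalSpace.mk' (EP →L[ℝ] EP)
      (E := fun p : P => TangentSpace 𝓘(ℝ, EP) p →L[ℝ] TangentSpace 𝓘(ℝ, EP) p) p (Θ p))
  vertical : ∀ p v, mfderiv 𝓘(ℝ, EP) 𝓘(ℝ, EB) 𝓑.proj p (Θ p v) = 0
  eq_self : ∀ p v, mfderiv 𝓘(ℝ, EP) 𝓘(ℝ, EB) 𝓑.proj p v = 0 → Θ p v = v
  moment : ∀ p v,
    mfderiv 𝓘(ℝ, EP) 𝓘(ℝ, EM) 𝓑.μ p (Θ p v) = mfderiv 𝓘(ℝ, EP) 𝓘(ℝ, EM) 𝓑.μ p v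
  invariant : ∀ g p, 𝓑.μ p = Γ.t g →
    𝓑.tangentAct g p '' {v | Θ p v = 0} = {w | Θ (𝓑.act p g) w = 0}

/-! ### The shadow bundle -/

/-- Local trivialisations of a principaloid bundle. -/
abbrev Triv : Type _ := LocalTrivialisation Γ EB EP 𝓑.proj 𝓑.μ 𝓑.act

section Triv

variable {𝓑}

theorem Triv.map_symm (T : 𝓑.Triv) {b : B} (hb : b ∈ T.O) (g : G) :
    𝓑.proj (T.τ.symm (b, g)) = b ∧ T.τ (T.τ.symm (b, g)) = (b, g) ∧
      𝓑.μ (T.τ.symm (b, g)) = Γ.s g := by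
  have ht : (b, g) ∈ T.τ.target := by rw [T.target_eq]; exact ⟨hb, mem_univ _⟩
  have h1 := T.τ.right_inv ht
  have h2 : 𝓑.proj (T.τ.symm (b, g)) ∈ T.O := by
    have := T.τ.map_target ht
    rwa [T.source_eq] at this
  refine ⟨?_, h1, ?_⟩
  · rw [← T.fst_apply _ h2, h1]
  · rw [← T.s_apply _ h2, h1]

theorem Triv.symm_eq (T : 𝓑.Triv) {b : B} (hb : b ∈ T.O) (g : G) :
    T.τ.symm (b, g) = 𝓑.act (T.τ.symm (b, Γ.one (Γ.t g))) g := by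
  obtain ⟨h1, h2, h3⟩ := T.map_symm hb (Γ.one (Γ.t g))
  rw [Γ.s_one] at h3
  have h4 := T.act_apply _ g (by rw [h1]; exact hb) h3
  rw [h1, h2, Γ.one_mul] at h4
  have hs : 𝓑.act (T.τ.symm (b, Γ.one (Γ.t g))) g ∈ T.τ.source := by
    rw [T.source_eq, mem_preimage, 𝓑.proj_act _ _ h3, h1]; exact hb
  rw [← h4, T.τ.left_inv hs]

/-- The transition map `t_*(β_{T' T}(b)) : M → M` of the shadow bundle between two local
trivialisations of `𝓑`, where `β_{T' T}(b)(m) = pr₂(T'(T⁻¹(b, Id_m)))` is the transition bisection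
and `t_* β = t ∘ β`. -/
def shadowChange (T T' : 𝓑.Triv) (b : B) (m : M) : M :=
  Γ.t (T'.τ (T.τ.symm (b, Γ.one m))).2

theorem shadowChange_t (T T' : 𝓑.Triv) {b : B} (hb : b ∈ T.O) (hb' : b ∈ T'.O) (g : G) :
    shadowChange T T' b (Γ.t g) = Γ.t (T'.τ (T.τ.symm (b, g))).2 := by
  obtain ⟨h1, h2, h3⟩ := T.map_symm hb (Γ.one (Γ.t g))
  rw [Γ.s_one] at h3
  have h5 : 𝓑.proj (T.τ.symm (b, Γ.one (Γ.t g))) ∈ T'.O := by rw [h1]; exact hb'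
  rw [T.symm_eq hb g, T'.act_apply _ g h5 h3, Γ.t_mul _ _ (by rw [T'.s_apply _ h5, h3])]
  rfl

theorem shadowChange_smooth (T T' : 𝓑.Triv) :
    ContMDiffOn (𝓘(ℝ, EB).prod 𝓘(ℝ, EM)) 𝓘(ℝ, EM) ∞
      (fun q : B × M => shadowChange T T' q.1 q.2) ((T.O ∩ T'.O) ×ˢ univ) := by
  have h1 : ContMDiff (𝓘(ℝ, EB).prod 𝓘(ℝ, EM)) (𝓘(ℝ, EB).prod 𝓘(ℝ, EG)) ∞
      (fun q : B × M => (q.1, Γ.one q.2)) :=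
    contMDiff_fst.prodMk (Γ.smooth_one.comp contMDiff_snd)
  have h2 := T.smooth_symm.comp (s := (T.O ∩ T'.O) ×ˢ univ) h1.contMDiffOn (by
    rintro ⟨b, m⟩ ⟨hb, -⟩
    rw [mem_preimage, T.target_eq]
    exact ⟨hb.1, mem_univ _⟩)
  have h3 := T'.smooth.comp h2 (by
    rintro ⟨b, m⟩ ⟨hb, -⟩
    rw [mem_preimage, T'.source_eq, mem_preimage]
    have := (T.map_symm hb.1 (Γ.one m)).1
    simp only [Function.comp]
    rw [this]
    exact hb.2)
  have h4 : ContMDiff 𝓘(ℝ, EG) 𝓘(ℝ, EM) ∞ Γ.t := Γ.submersion_t.contMDiff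
  exact (h4.comp contMDiff_snd).comp_contMDiffOn h3

end Triv

/-- The shadow bundle is glued from the products `O × M` by the shadow action `t_*` of the
transition bisections of `𝓑` between its equivariant local trivialisations. -/
def shadowCore : FiberBundleCore 𝓑.Triv B M where
  baseSet T := T.O
  isOpen_baseSet T := T.isOpen_O
  indexAt b := (𝓑.locally_trivial b).choose
  mem_baseSet_at b := (𝓑.locally_trivial b).choose_spec
  coordChange := shadowChange
  coordChange_self T b hb m := by
    rw [shadowChange, (T.map_symm hb _).2.1, Γ.t_one]
  continuousOn_coordChange T T' := (shadowChange_smooth T T').continuousOn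
  coordChange_comp T T' T'' b hb m := by
    obtain ⟨h1, h2, h3⟩ := T.map_symm hb.1.1 (Γ.one m)
    have h5 : T.τ.symm (b, Γ.one m) ∈ T'.τ.source := by
      rw [T'.source_eq, mem_preimage, h1]; exact hb.1.2
    have h6 : (b, (T'.τ (T.τ.symm (b, Γ.one m))).2) = T'.τ (T.τ.symm (b, Γ.one m)) := by
      refine Prod.ext ?_ rfl
      rw [T'.fst_apply _ (by rw [h1]; exact hb.1.2), h1]
    rw [shadowChange, shadowChange, ← shadowChange, shadowChange_t T' T'' hb.1.2 hb.2, h6,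
      T'.τ.left_inv h5]
    rfl

/-- The total space `F` of the shadow bundle. -/
abbrev Shadow : Type _ := 𝓑.shadowCore.TotalSpace

/-- The bundle projection of the shadow bundle. -/
def shadowProj : 𝓑.Shadow → B := fun f => f.proj

instance shadowChartedSpace : ChartedSpace (ModelProd EB EM) 𝓑.Shadow :=
  ChartedSpace.comp (ModelProd EB EM) (B × M) 𝓑.Shadow

/-- The sitting-duck map `P → F`, given by `id × t` in the local trivialisations. -/
def duck (p : P) : 𝓑.Shadow :=
  ⟨𝓑.proj p, Γ.t ((𝓑.shadowCore.indexAt (𝓑.proj p)).τ p).2⟩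

/-- The total space of the shadow bundle is a smooth manifold. -/
instance shadowIsManifold [IsManifold 𝓘(ℝ, EB) ∞ B] [IsManifold 𝓘(ℝ, EM) ∞ M] :
    IsManifold (𝓘(ℝ, EB).prod 𝓘(ℝ, EM)) ∞ 𝓑.Shadow := by
  refine isManifold_of_contDiffOn _ _ _ ?_
  rintro _ _ ⟨_, ⟨_, ⟨T, rfl⟩, rfl⟩, c, hc, rfl⟩ ⟨_, ⟨_, ⟨T', rfl⟩, rfl⟩, c', hc', rfl⟩
  have hF : ContMDiffOn (𝓘(ℝ, EB).prod 𝓘(ℝ, EM)) (𝓘(ℝ, EB).prod 𝓘(ℝ, EM)) ∞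
      (fun q : B × M => (q.1, shadowChange T T' q.1 q.2)) ((T.O ∩ T'.O) ×ˢ univ) :=
    contMDiff_fst.contMDiffOn.prodMk (shadowChange_smooth T T')
  have hc1 := contMDiffOn_symm_of_mem_maximalAtlas (I := 𝓘(ℝ, EB).prod 𝓘(ℝ, EM)) (n := ∞)
    (IsManifold.subset_maximalAtlas hc)
  have hc2 := contMDiffOn_of_mem_maximalAtlas (I := 𝓘(ℝ, EB).prod 𝓘(ℝ, EM)) (n := ∞)
    (IsManifold.subset_maximalAtlas hc')
  have h1 := hF.comp (s := c.target ∩ c.symm ⁻¹' ((T.O ∩ T'.O) ×ˢ univ))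
    (hc1.mono inter_subset_left) inter_subset_right
  have h2 := hc2.comp (s := (c.target ∩ c.symm ⁻¹' ((T.O ∩ T'.O) ×ˢ univ)) ∩
    ((fun q : B × M => (q.1, shadowChange T T' q.1 q.2)) ∘ c.symm) ⁻¹' c'.source)
    (h1.mono inter_subset_left) inter_subset_right
  rw [← contMDiffOn_iff_contDiffOn, modelWithCornersSelf_prod]
  have key : ∀ q : B × M, q.1 ∈ T.O → q.1 ∈ T'.O →
      𝓑.shadowCore.coordChange (𝓑.shadowCore.indexAt q.1) T' q.1
        (𝓑.shadowCore.coordChange T (𝓑.shadowCore.indexAt q.1) q.1 q.2) =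
      shadowChange T T' q.1 q.2 := fun q h h' =>
    𝓑.shadowCore.coordChange_comp _ _ _ _ ⟨⟨h, 𝓑.shadowCore.mem_baseSet_at _⟩, h'⟩ _
  refine h2.congr_mono (f₁ := c' ∘ (𝓑.shadowCore.localTriv T') ∘
    (𝓑.shadowCore.localTriv T).toOpenPartialHomeomorph.symm ∘ c.symm) ?_ ?_
  · rintro x ⟨hx, -⟩
    simp only [mfld_simps] at hx
    have hk := key _ hx.1.2 hx.2.1
    exact congrArg c' (Prod.ext rfl hk)
  · rintro x ⟨hx, -⟩
    simp only [mfld_simps] at hx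
    have hk := key _ hx.1.2 hx.2.1
    refine ⟨⟨hx.1.1, ⟨hx.1.2, hx.2.1⟩, mem_univ _⟩, ?_⟩
    have h3 := hx.2.2
    rw [hk] at h3
    exact h3

/-- In every local trivialisation the sitting-duck map is `(b, g) ↦ (b, t g)`. -/
theorem localTriv_duck (T : 𝓑.Triv) (p : P) (hp : 𝓑.proj p ∈ T.O) :
    𝓑.shadowCore.localTriv T (𝓑.duck p) = (𝓑.proj p, Γ.t (T.τ p).2) := by
  set T₀ : 𝓑.Triv := 𝓑.shadowCore.indexAt (𝓑.proj p) with hT₀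
  have h0 : 𝓑.proj p ∈ T₀.O := 𝓑.shadowCore.mem_baseSet_at _
  have h1 : T₀.τ.symm (𝓑.proj p, (T₀.τ p).2) = p := by
    have hs : p ∈ T₀.τ.source := by rw [T₀.source_eq]; exact h0
    rw [← T₀.fst_apply p h0, Prod.mk.eta, T₀.τ.left_inv hs]
  refine Prod.ext rfl ?_
  change shadowChange T₀ T (𝓑.proj p) (Γ.t (T₀.τ p).2) = _
  rw [shadowChange_t T₀ T h0 hp, h1]

namespace ConnectionForm

variable {𝓑} [IsManifold 𝓘(ℝ, EP) ∞ P] (Φ : 𝓑.ConnectionForm)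

/-- The horizontal distribution `H P = ker Θ`. -/
def horizontal : Set (TangentBundle 𝓘(ℝ, EP) P) :=
  {X | Φ.Θ X.1 X.2 = 0}

/-- The horizontal distribution `H F = T D (H P)` of the shadow connection, where `D : P → F` is the
sitting-duck map. -/
def shadowHorizontal : Set (TangentBundle (𝓘(ℝ, EB).prod 𝓘(ℝ, EM)) 𝓑.Shadow) :=
  tangentMap 𝓘(ℝ, EP) (𝓘(ℝ, EB).prod 𝓘(ℝ, EM)) 𝓑.duck '' Φ.horizontal

/-- The connection on `P` is complete. -/
def IsComplete : Prop :=
  IsCompleteDistribution (EB := EB) 𝓘(ℝ, EP) 𝓑.proj Φ.horizontal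

/-- The shadow connection on `F` is complete. -/
def ShadowIsComplete : Prop :=
  IsCompleteDistribution (EB := EB) (𝓘(ℝ, EB).prod 𝓘(ℝ, EM)) 𝓑.shadowProj Φ.shadowHorizontal

end ConnectionForm

end PrincipaloidBundle

end Principaloid

end

/-! In a bundle chart, a horizontal lift of a curve γ solves an ordinary differential equation with
smooth right-hand side, so lifts exist and are unique locally. The danger is that the time of
existence shrinks as a lift runs off along the fibre `G`, and the groupoid action prevents this.
Since T μ ∘ Θ = T μ, the moment map is constant along a horizontal lift. An arrow that acts on one
point of the lift therefore acts on all of it, and the translated curve is a horizontal lift over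
the same interval. Over O × G the point (b, g) is the translate by g of (b, Id_{t(g)}). Hence a
lower bound for the time of existence of lifts starting near Id_m holds for all starting points,
however far out in `G`, whose shadow is near m (`exists_isLiftAt_of_shadow_nhds`).

It remains to control the shadow. If `M` is compact, finitely many of these neighbourhoods of
objects cover it, and the time is uniform over whole fibres (`isComplete_of_compactSpace`). If the
shadow connection is complete, γ has a shadow lift f on all of J, and one looks for lifts whose
shadow is f. For a short time f stays near its value at a given instant, so the time is again
uniform (`isComplete_of_shadowIsComplete`). The lifts found do stay over f, because shadows of
horizontal lifts are horizontal and horizontal lifts to the shadow bundle are unique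
(`eqOn_of_shadowHorizontal`).

Local uniqueness and a locally uniform time of existence give global lifts by an open-and-closed
argument on the interval (`exists_global_of_local`). -/

noncomputable section

/-! ## Curves: local uniqueness and gluing -/

section Curves

variable {X : Type*} [TopologicalSpace X]

/-- Two continuous curves on a connected open set of times which agree near each time of agreement
and agree at one time are equal. -/
theorem eqOn_of_forall_eventuallyEq [T2Space X] {I : Set ℝ} (hI : IsOpen I)
    (hconn : IsPreconnected I) {c₁ c₂ : ℝ → X} (h₁ : ContinuousOn c₁ I) (h₂ : ContinuousOn c₂ I)
    (huniq : ∀ t ∈ I, c₁ t = c₂ t → c₁ =ᶠ[𝓝 t] c₂) {t₀ : ℝ} (ht₀ : t₀ ∈ I)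
    (heq : c₁ t₀ = c₂ t₀) : EqOn c₁ c₂ I := by
  have hu : IsOpen {t | c₁ =ᶠ[𝓝 t] c₂} := isOpen_setOfPred_eventually_nhds
  have hsub : I ⊆ {t | c₁ =ᶠ[𝓝 t] c₂} := by
    refine hconn.subset_of_closure_inter_subset hu ⟨t₀, ht₀, huniq t₀ ht₀ heq⟩ ?_
    rintro t ⟨htc, htI⟩
    refine huniq t htI ?_
    have hfr : ∃ᶠ s in 𝓝 t, c₁ s = c₂ s :=
      (mem_closure_iff_frequently.1 htc).mono fun s hs => hs.self_of_nhds
    exact tendsto_nhds_unique_of_frequently_eq (h₁.continuousAt (hI.mem_nhds htI))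
      (h₂.continuousAt (hI.mem_nhds htI)) hfr
  exact fun t ht => (hsub ht).self_of_nhds

/-- Solutions of a local problem for curves (`S c t` expresses that `c` solves the problem at time
`t`) which are locally unique, and exist for a time that is locally uniform in the initial values
allowed by `Q`, exist globally on an interval. -/
theorem exists_global_of_local [T2Space X] {J : Set ℝ} (hJc : J.OrdConnected)
    {S : (ℝ → X) → ℝ → Prop} {Q : ℝ → X → Prop}
    (hcongr : ∀ {c₁ c₂ : ℝ → X} {t : ℝ}, c₁ =ᶠ[𝓝 t] c₂ → S c₁ t → S c₂ t)
    (hcont : ∀ {c : ℝ → X} {t : ℝ}, S c t → ContinuousAt c t)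
    (hQ : ∀ {c : ℝ → X} {t : ℝ}, S c t → Q t (c t))
    (huniq : ∀ (c₁ c₂ : ℝ → X), ∀ t ∈ J, (∀ᶠ u in 𝓝 t, S c₁ u) → (∀ᶠ u in 𝓝 t, S c₂ u) →
      c₁ t = c₂ t → c₁ =ᶠ[𝓝 t] c₂)
    (hex : ∀ τ₀ ∈ J, ∃ I : Set ℝ, IsOpen I ∧ I.OrdConnected ∧ τ₀ ∈ I ∧ I ⊆ J ∧
      ∀ τ ∈ I, ∀ x, Q τ x → ∃ c : ℝ → X, c τ = x ∧ ∀ t ∈ I, S c t)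
    {t₀ : ℝ} (ht₀ : t₀ ∈ J) {x₀ : X} (hx₀ : Q t₀ x₀) :
    ∃ c : ℝ → X, c t₀ = x₀ ∧ ∀ t ∈ J, S c t := by
  have huniq' : ∀ {c₁ c₂ : ℝ → X} {I₁ I₂ : Set ℝ}, IsOpen I₁ → IsOpen I₂ → I₁.OrdConnected →
      I₂.OrdConnected → I₁ ⊆ J → (∀ t ∈ I₁, S c₁ t) → (∀ t ∈ I₂, S c₂ t) →
      ∀ {t : ℝ}, t ∈ I₁ → t ∈ I₂ → c₁ t = c₂ t → EqOn c₁ c₂ (I₁ ∩ I₂) := by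
    intro c₁ c₂ I₁ I₂ ho₁ ho₂ hc₁ hc₂ hIJ h₁ h₂ t ht₁ ht₂ heq
    have ho := ho₁.inter ho₂
    refine eqOn_of_forall_eventuallyEq ho (hc₁.inter hc₂).isPreconnected
      (fun t ht => (hcont (h₁ t ht.1)).continuousWithinAt)
      (fun t ht => (hcont (h₂ t ht.2)).continuousWithinAt) ?_ ⟨ht₁, ht₂⟩ heq
    intro s hs hse
    exact huniq _ _ s (hIJ hs.1) (mem_of_superset (ho.mem_nhds hs) fun u hu => h₁ u hu.1)
      (mem_of_superset (ho.mem_nhds hs) fun u hu => h₂ u hu.2) hse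
  -- The times reached from `t₀` by a solution on a connected open set of times; they form an open
  -- set that is closed in `J`.
  let R : ℝ → Prop := fun t => ∃ (I : Set ℝ) (c : ℝ → X), IsOpen I ∧ I.OrdConnected ∧ I ⊆ J ∧
    t₀ ∈ I ∧ t ∈ I ∧ c t₀ = x₀ ∧ ∀ u ∈ I, S c u
  have hRo : IsOpen {t | R t} := by
    refine isOpen_iff_mem_nhds.2 ?_
    rintro t ⟨I, c, ho, hc, hIJ, h0, ht, hx, hS⟩
    exact mem_of_superset (ho.mem_nhds ht) fun u hu => ⟨I, c, ho, hc, hIJ, h0, hu, hx, hS⟩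
  have hRJ : J ⊆ {t | R t} := by
    refine hJc.isPreconnected.subset_of_closure_inter_subset hRo ⟨t₀, ht₀, ?_⟩ ?_
    · obtain ⟨I, ho, hc, h0, hIJ, hI⟩ := hex t₀ ht₀
      obtain ⟨c, hx, hS⟩ := hI t₀ h0 x₀ hx₀
      exact ⟨I, c, ho, hc, hIJ, h0, h0, hx, hS⟩
    · rintro t ⟨htc, htJ⟩
      obtain ⟨I₁, ho₁, hc₁, h1, hIJ₁, hI₁⟩ := hex t htJ
      obtain ⟨s, hsI₁, I, c, ho, hc, hIJ, h0, hs, hx, hS⟩ :=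
        mem_closure_iff.1 htc I₁ ho₁ h1
      -- Restart at a reached time `s` close to the limit time `t`. Since `I₁` was fixed before the
      -- initial time and value, the new solution reaches past `t`.
      obtain ⟨c₁, hx₁, hS₁⟩ := hI₁ s hsI₁ (c s) (hQ (hS s hs))
      have hE : EqOn c c₁ (I ∩ I₁) := huniq' ho ho₁ hc hc₁ hIJ hS hS₁ hs hsI₁ hx₁.symm
      classical
      refine ⟨I ∪ I₁, I.piecewise c c₁, ho.union ho₁, ?_, union_subset hIJ hIJ₁, Or.inl h0,
        Or.inr h1, by rw [piecewise_eq_of_mem _ _ _ h0, hx], ?_⟩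
      · exact (hc.isPreconnected.union s hs hsI₁ hc₁.isPreconnected).ordConnected
      · rintro u (hu | hu)
        · refine hcongr ?_ (hS u hu)
          filter_upwards [ho.mem_nhds hu] with v hv
          rw [piecewise_eq_of_mem _ _ _ hv]
        · refine hcongr ?_ (hS₁ u hu)
          filter_upwards [ho₁.mem_nhds hu] with v hv
          by_cases hvI : v ∈ I
          · rw [piecewise_eq_of_mem _ _ _ hvI, hE ⟨hvI, hv⟩]
          · rw [piecewise_eq_of_notMem _ _ _ hvI]
  have hRJ' : ∀ t : J, R t := fun t => hRJ t.2
  choose I c ho hc hIJ h0 ht hx hS using hRJ'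
  classical
  -- Diagonal gluing: all the local solutions start at `x₀`, so they agree on overlaps. The value
  -- off `J` plays no role, because near each time of `J` only times of `J` matter.
  let C : ℝ → X := fun t => if h : t ∈ J then c ⟨t, h⟩ t else x₀
  have hC : ∀ t : J, EqOn (c t) C (I t) := by
    intro t s hs
    have hsJ := hIJ t hs
    simp only [C, dif_pos hsJ]
    exact huniq' (ho t) (ho ⟨s, hsJ⟩) (hc _) (hc _) (hIJ _) (hS _) (hS _) (h0 _) (h0 _)
      ((hx _).trans (hx _).symm) ⟨hs, ht _⟩
  refine ⟨C, ?_, fun t htJ => ?_⟩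
  · simp only [C, dif_pos ht₀, hx]
  · refine hcongr ?_ (hS ⟨t, htJ⟩ t (ht _))
    filter_upwards [(ho ⟨t, htJ⟩).mem_nhds (ht _)] with s hs using hC ⟨t, htJ⟩ hs

end Curves

/-! ## Ordinary differential equations with smooth right-hand side -/

section ODE

variable {E : Type*} [NormedAddCommGroup E] [NormedSpace ℝ E]

/-- A C¹ right-hand side is Lipschitz near the common initial value, and by continuity both
solutions stay there for a short time, so Grönwall uniqueness applies. -/
theorem eventuallyEq_of_hasDerivAt {f : ℝ × E → E} {t₀ : ℝ} {y₁ y₂ : ℝ → E}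
    (hf : ContDiffAt ℝ 1 f (t₀, y₁ t₀))
    (h₁ : ∀ᶠ t in 𝓝 t₀, HasDerivAt y₁ (f (t, y₁ t)) t)
    (h₂ : ∀ᶠ t in 𝓝 t₀, HasDerivAt y₂ (f (t, y₂ t)) t) (heq : y₁ t₀ = y₂ t₀) :
    y₁ =ᶠ[𝓝 t₀] y₂ := by
  obtain ⟨K, s, hs, hl⟩ := hf.exists_lipschitzOnWith
  have hlip : ∀ t, LipschitzOnWith K (fun y => f (t, y)) {y | (t, y) ∈ s} := by
    intro t y hy z hz
    have := hl hy hz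
    rwa [Prod.edist_eq, edist_self, max_eq_right (zero_le)] at this
  have c₁ : ContinuousAt (fun t => (t, y₁ t)) t₀ :=
    continuousAt_id.prodMk h₁.self_of_nhds.continuousAt
  have c₂ : ContinuousAt (fun t => (t, y₂ t)) t₀ :=
    continuousAt_id.prodMk h₂.self_of_nhds.continuousAt
  refine ODE_solution_unique_of_eventually (v := fun t y => f (t, y)) (K := K)
    (s := fun t => {y | (t, y) ∈ s}) (Eventually.of_forall hlip)
    (h₁.and (c₁.eventually_mem hs)) (h₂.and (c₂.eventually_mem ?_)) heq
  rwa [← heq]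

/-- The Picard-Lindelöf theorem, recording that the solution stays in the given ball. -/
theorem IsPicardLindelof.exists_hasDerivWithinAt_mem_closedBall [CompleteSpace E] {f : ℝ → E → E}
    {tmin tmax : ℝ} {t₀ : Icc tmin tmax} {x₀ x : E} {a r L K : NNReal}
    (hf : IsPicardLindelof f t₀ x₀ a r L K) (hx : x ∈ Metric.closedBall x₀ r) :
    ∃ α : ℝ → E, α t₀ = x ∧ (∀ t, α t ∈ Metric.closedBall x₀ a) ∧
      ∀ t ∈ Icc tmin tmax, HasDerivWithinAt α (f t (α t)) (Icc tmin tmax) t := by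
  obtain ⟨α, hα⟩ := ODE.FunSpace.exists_isFixedPt_next hf hx
  refine ⟨α.compProj, ?_, fun t => α.compProj_mem_closedBall hf.mul_max_le, fun t ht => ?_⟩
  · rw [ODE.FunSpace.compProj_val, ← hα, ODE.FunSpace.next_apply₀]
  · refine (ODE.hasDerivWithinAt_picard_Icc t₀.2 hf.continuousOn_uncurry
      α.continuous_compProj.continuousOn (fun t _ => α.compProj_mem_closedBall hf.mul_max_le)
      x ht).congr_of_mem ?_ ht
    intro t' ht'
    nth_rw 1 [← hα]
    rw [ODE.FunSpace.compProj_of_mem ht', ODE.FunSpace.next_apply]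

/-- Solutions of an ordinary differential equation with smooth right-hand side exist for a time that
is locally uniform in the initial time and the initial value. -/
theorem exists_uniform_hasDerivAt [CompleteSpace E] {f : ℝ × E → E} {U : Set (ℝ × E)}
    (hU : IsOpen U) (hf : ContDiffOn ℝ ∞ f U) {t₀ : ℝ} {y₀ : E} (h0 : (t₀, y₀) ∈ U) :
    ∃ ε > 0, ∃ r > 0, ∀ τ ∈ Ioo (t₀ - ε) (t₀ + ε), ∀ y ∈ Metric.closedBall y₀ r,
      ∃ α : ℝ → E, α τ = y ∧ ContDiffOn ℝ ∞ α (Ioo (t₀ - ε) (t₀ + ε)) ∧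
        ∀ t ∈ Ioo (t₀ - ε) (t₀ + ε), (t, α t) ∈ U ∧ HasDerivAt α (f (t, α t)) t := by
  have hfa : ContDiffAt ℝ ∞ f (t₀, y₀) := hf.contDiffAt (hU.mem_nhds h0)
  obtain ⟨K, s, hs, hl⟩ := (hfa.of_le (by exact_mod_cast le_top)).exists_lipschitzOnWith
  obtain ⟨L, hL0, hL⟩ : ∃ L : ℝ, 0 < L ∧ ∀ᶠ z in 𝓝 (t₀, y₀), ‖f z‖ ≤ L := by
    refine ⟨‖f (t₀, y₀)‖ + 1, by positivity, ?_⟩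
    exact (hfa.continuousAt.norm.eventually_lt_const (lt_add_one _)).mono fun z hz => hz.le
  obtain ⟨δ, hδ, hball⟩ := Metric.mem_nhds_iff.1 (inter_mem (inter_mem hs hL) (hU.mem_nhds h0))
  set a : ℝ := δ / 2 with ha
  have ha0 : 0 < a := by positivity
  set ε : ℝ := min a (a / (4 * L)) with hε
  have hε0 : 0 < ε := by positivity
  have hmem : ∀ t ∈ Icc (t₀ - ε) (t₀ + ε), ∀ y ∈ Metric.closedBall y₀ a,
      (t, y) ∈ (s ∩ {z | ‖f z‖ ≤ L}) ∩ U := by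
    intro t ht y hy
    refine hball ?_
    rw [Metric.mem_ball, Prod.dist_eq, max_lt_iff]
    have h1 : ε ≤ a := min_le_left _ _
    have h2 : a < δ := by rw [ha]; linarith
    refine ⟨lt_of_le_of_lt ?_ h2, lt_of_le_of_lt hy h2⟩
    rw [Real.dist_eq, abs_le]
    constructor <;> linarith [ht.1, ht.2]
  refine ⟨ε, hε0, a / 2, by positivity, fun τ hτ y hy => ?_⟩
  have hpl : IsPicardLindelof (fun t y => f (t, y)) (tmin := t₀ - ε) (tmax := t₀ + ε)
      ⟨τ, Ioo_subset_Icc_self hτ⟩ y₀ ⟨a, ha0.le⟩ ⟨a / 2, by positivity⟩ ⟨L, hL0.le⟩ K := by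
    refine ⟨?_, ?_, ?_, ?_⟩
    · intro t ht y hy z hz
      have := hl (hmem t ht y hy).1.1 (hmem t ht z hz).1.1
      rwa [Prod.edist_eq, edist_self, max_eq_right (zero_le)] at this
    · intro y hy
      exact hf.continuousOn.comp (continuousOn_id.prodMk continuousOn_const)
        fun t ht => (hmem t ht y hy).2
    · intro t ht y hy
      exact (hmem t ht y hy).1.2
    · have h1 : max (t₀ + ε - τ) (τ - (t₀ - ε)) ≤ 2 * ε := by
        refine max_le ?_ ?_ <;> linarith [hτ.1, hτ.2]
      have h2 : ε ≤ a / (4 * L) := min_le_right _ _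
      change L * max (t₀ + ε - τ) (τ - (t₀ - ε)) ≤ a - a / 2
      calc L * max (t₀ + ε - τ) (τ - (t₀ - ε)) ≤ L * (2 * (a / (4 * L))) := by gcongr; linarith
        _ = a - a / 2 := by field_simp; ring
  obtain ⟨α, hατ, hball', hder⟩ := hpl.exists_hasDerivWithinAt_mem_closedBall hy
  have hsm : ContDiffOn ℝ ∞ α (Icc (t₀ - ε) (t₀ + ε)) := by
    refine ODE.contDiffOn_enat_Icc_of_hasDerivWithinAt (n := ⊤) (f := fun t y => f (t, y))
      (u := Metric.closedBall y₀ a) ?_ hder fun t _ => hball' t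
    exact hf.mono fun z hz => (hmem z.1 hz.1 z.2 hz.2).2
  refine ⟨α, hατ, hsm.mono Ioo_subset_Icc_self, fun t ht => ⟨?_, ?_⟩⟩
  · exact (hmem t (Ioo_subset_Icc_self ht) _ (hball' t)).2
  · exact (hder t (Ioo_subset_Icc_self ht)).hasDerivAt (Icc_mem_nhds ht.1 ht.2)

end ODE

/-! ## Endomorphism fields in coordinates -/

section Coordinates

variable {E F X : Type*} [NormedAddCommGroup E] [NormedSpace ℝ E] [NormedAddCommGroup F]
  [NormedSpace ℝ F] [TopologicalSpace X] [ChartedSpace E X]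

/-- The chain rule for a curve followed by a map to a vector space. -/
theorem hasDerivAt_comp_curve {EX HX X : Type*} [NormedAddCommGroup EX] [NormedSpace ℝ EX]
    [TopologicalSpace HX] {IX : ModelWithCorners ℝ EX HX} [TopologicalSpace X] [ChartedSpace HX X]
    {f : X → F} {c : ℝ → X} {t : ℝ} (hf : MDifferentiableAt IX 𝓘(ℝ, F) f (c t))
    (hc : MDifferentiableAt 𝓘(ℝ, ℝ) IX c t) :
    HasDerivAt (f ∘ c)
      (mfderiv IX 𝓘(ℝ, F) f (c t) (mfderiv 𝓘(ℝ, ℝ) IX c t (1 : ℝ)) : F) t := by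
  let D : EX →L[ℝ] F := mfderiv IX 𝓘(ℝ, F) f (c t)
  let D' : ℝ →L[ℝ] EX := mfderiv 𝓘(ℝ, ℝ) IX c t
  have h : HasFDerivAt (f ∘ c) (D.comp D') t :=
    hasMFDerivAt_iff_hasFDerivAt.1 (hf.hasMFDerivAt.comp t hc.hasMFDerivAt)
  exact h.hasDerivAt

/-- Every tangent space is by definition a copy of `EX`, so vectors at provably equal points can be
compared there without transport. -/
theorem tangentBundle_mk_eq {EX HX X : Type*} [NormedAddCommGroup EX] [NormedSpace ℝ EX]
    [TopologicalSpace HX] {IX : ModelWithCorners ℝ EX HX} [TopologicalSpace X] [ChartedSpace HX X]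
    {x y : X} (h : x = y) {v : TangentSpace IX x} {w : TangentSpace IX y}
    (hv : (v : EX) = (w : EX)) : (⟨x, v⟩ : TangentBundle IX X) = ⟨y, w⟩ := by
  subst h
  exact congrArg _ hv

/-- Smoothness of Θ as a section of an endomorphism bundle becomes smoothness of its coefficients in
coordinates: a constant field is pushed forward by `e.symm`, Θ is applied, and the result is pushed
forward by `e`. -/
theorem contDiffOn_endomorphism_apply [IsManifold 𝓘(ℝ, E) ∞ X]
    {Θ : ∀ x : X, TangentSpace 𝓘(ℝ, E) x →L[ℝ] TangentSpace 𝓘(ℝ, E) x}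
    (hΘ : ContMDiff 𝓘(ℝ, E) (𝓘(ℝ, E).prod 𝓘(ℝ, E →L[ℝ] E)) ∞
      (fun x => TotalSpace.mk' (E →L[ℝ] E)
        (E := fun x : X => TangentSpace 𝓘(ℝ, E) x →L[ℝ] TangentSpace 𝓘(ℝ, E) x) x (Θ x)))
    {e : OpenPartialHomeomorph X F}
    (he : ContMDiffOn 𝓘(ℝ, E) 𝓘(ℝ, F) ∞ e e.source)
    (he' : ContMDiffOn 𝓘(ℝ, F) 𝓘(ℝ, E) ∞ e.symm e.target) (v : F) :
    ContDiffOn ℝ ∞ (fun z : F => (mfderiv 𝓘(ℝ, E) 𝓘(ℝ, F) e (e.symm z)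
      (Θ (e.symm z) (mfderiv 𝓘(ℝ, F) 𝓘(ℝ, E) e.symm z v)) : F)) e.target := by
  have h1 : ContMDiffOn 𝓘(ℝ, F) 𝓘(ℝ, F).tangent ∞
      (fun z => (⟨z, v⟩ : TangentBundle 𝓘(ℝ, F) F)) e.target :=
    contMDiffOn_vectorSpace_iff_contDiffOn.2 contDiffOn_const
  have h2 : ContMDiffOn 𝓘(ℝ, F) 𝓘(ℝ, E).tangent ∞
      (fun z => (⟨e.symm z, mfderiv 𝓘(ℝ, F) 𝓘(ℝ, E) e.symm z v⟩ : TangentBundle 𝓘(ℝ, E) X))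
      e.target := by
    refine ((he'.contMDiffOn_tangentMapWithin (m := ∞) le_rfl
      e.open_target.uniqueMDiffOn).comp h1 fun z hz => hz).congr fun z hz => ?_
    simp only [Function.comp, tangentMapWithin, mfderivWithin_of_isOpen e.open_target hz]
  have h3 := (hΘ.comp_contMDiffOn he').clm_bundle_apply h2
  have h4 := (contMDiff_snd_tangentBundle_modelSpace (n := ∞) F 𝓘(ℝ, F)).comp_contMDiffOn
    ((he.contMDiffOn_tangentMapWithin (m := ∞) le_rfl e.open_source.uniqueMDiffOn).comp h3
      fun z hz => e.map_target hz)
  refine (contMDiffOn_iff_contDiffOn.1 h4).congr fun z hz => ?_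
  simp only [Function.comp, tangentMapWithin,
    mfderivWithin_of_isOpen e.open_source (e.map_target hz)]
  rfl

end Coordinates

namespace PrincipaloidBundle

variable {EM EG EB EP M G B P : Type*}
  [NormedAddCommGroup EM] [NormedSpace ℝ EM] [NormedAddCommGroup EG] [NormedSpace ℝ EG]
  [NormedAddCommGroup EB] [NormedSpace ℝ EB] [NormedAddCommGroup EP] [NormedSpace ℝ EP]
  [TopologicalSpace M] [ChartedSpace EM M] [TopologicalSpace G] [ChartedSpace EG G]
  [TopologicalSpace B] [ChartedSpace EB B] [TopologicalSpace P] [ChartedSpace EP P]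
  {Γ : LieGroupoid EM EG M G} {𝓑 : PrincipaloidBundle Γ EB EP B P}

/-! ### Bundle charts -/

/-- The chart of the total space given by a local trivialisation and charts of the base and of the
groupoid. -/
def Triv.coord (T : 𝓑.Triv) (b : B) (g : G) : OpenPartialHomeomorph P (EB × EG) :=
  T.τ ≫ₕ (chartAt EB b).prod (chartAt EG g)

theorem mdifferentiableAt_proj (𝓑 : PrincipaloidBundle Γ EB EP B P) (p : P) : MDifferentiableAt 𝓘(ℝ, EP) 𝓘(ℝ, EB) 𝓑.proj p :=
  𝓑.submersion_proj.contMDiff.mdifferentiable (by simp) p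

namespace Triv

variable {T : 𝓑.Triv} {b : B} {g : G}

theorem mem_coord_source {p : P} : p ∈ (T.coord b g).source ↔
    𝓑.proj p ∈ T.O ∧ 𝓑.proj p ∈ (chartAt EB b).source ∧ (T.τ p).2 ∈ (chartAt EG g).source := by
  simp only [coord, OpenPartialHomeomorph.trans_source, T.source_eq, mem_inter_iff, mem_preimage,
    OpenPartialHomeomorph.prod_source, mem_prod]
  refine and_congr_right fun h => ?_
  rw [T.fst_apply p h]

theorem coord_apply {p : P} (hp : 𝓑.proj p ∈ T.O) :
    T.coord b g p = (chartAt EB b (𝓑.proj p), chartAt EG g (T.τ p).2) := by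
  rw [← T.fst_apply p hp]; rfl

theorem coord_symm_apply (z : EB × EG) :
    (T.coord b g).symm z = T.τ.symm ((chartAt EB b).symm z.1, (chartAt EG g).symm z.2) := rfl

theorem mem_coord_target {z : EB × EG} : z ∈ (T.coord b g).target ↔
    z.1 ∈ (chartAt EB b).target ∧ (chartAt EB b).symm z.1 ∈ T.O ∧
      z.2 ∈ (chartAt EG g).target := by
  simp only [coord, OpenPartialHomeomorph.trans_target, T.target_eq, mem_inter_iff, mem_preimage,
    OpenPartialHomeomorph.prod_target, mem_prod]
  constructor
  · rintro ⟨⟨h1, h2⟩, h3, -⟩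
    exact ⟨h1, h3, h2⟩
  · rintro ⟨h1, h2, h3⟩
    exact ⟨⟨h1, h3⟩, h2, mem_univ _⟩

variable [IsManifold 𝓘(ℝ, EB) ∞ B] [IsManifold 𝓘(ℝ, EG) ∞ G]

theorem contMDiffOn_coord :
    ContMDiffOn 𝓘(ℝ, EP) 𝓘(ℝ, EB × EG) ∞ (T.coord b g) (T.coord b g).source := by
  have h : ContMDiffOn 𝓘(ℝ, EP) (𝓘(ℝ, EB).prod 𝓘(ℝ, EG)) ∞ T.τ (T.coord b g).source :=
    T.smooth.mono fun p hp => by rw [T.source_eq]; exact (mem_coord_source.1 hp).1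
  refine ContMDiffOn.prodMk_space (f := fun p => chartAt EB b (T.τ p).1)
    (g := fun p => chartAt EG g (T.τ p).2) ?_ ?_
  · refine contMDiffOn_chart.comp (contMDiff_fst.comp_contMDiffOn h) fun p hp => ?_
    have hp := mem_coord_source.1 hp
    simp only [mem_preimage, T.fst_apply p hp.1]
    exact hp.2.1
  · exact contMDiffOn_chart.comp (contMDiff_snd.comp_contMDiffOn h)
      fun p hp => (mem_coord_source.1 hp).2.2

theorem contMDiffOn_coord_symm :
    ContMDiffOn 𝓘(ℝ, EB × EG) 𝓘(ℝ, EP) ∞ (T.coord b g).symm (T.coord b g).target := by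
  refine T.smooth_symm.comp (f := fun z : EB × EG =>
    ((chartAt EB b).symm z.1, (chartAt EG g).symm z.2)) (ContMDiffOn.prodMk ?_ ?_) ?_
  · exact contMDiffOn_chart_symm.comp contDiff_fst.contMDiff.contMDiffOn
      fun z hz => (mem_coord_target.1 hz).1
  · exact contMDiffOn_chart_symm.comp contDiff_snd.contMDiff.contMDiffOn
      fun z hz => (mem_coord_target.1 hz).2.2
  · intro z hz
    rw [mem_preimage, T.target_eq]
    exact ⟨(mem_coord_target.1 hz).2.1, mem_univ _⟩

theorem mdifferentiable_coord :
    (T.coord b g).MDifferentiable 𝓘(ℝ, EP) 𝓘(ℝ, EB × EG) :=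
  ⟨contMDiffOn_coord.mdifferentiableOn (by simp),
    contMDiffOn_coord_symm.mdifferentiableOn (by simp)⟩

theorem mfderiv_coord_fst {p : P} (hp : p ∈ (T.coord b g).source) (v : TangentSpace 𝓘(ℝ, EP) p) :
    (mfderiv 𝓘(ℝ, EP) 𝓘(ℝ, EB × EG) (T.coord b g) p v).1 =
      mfderiv 𝓘(ℝ, EB) 𝓘(ℝ, EB) (chartAt EB b) (𝓑.proj p)
        (mfderiv 𝓘(ℝ, EP) 𝓘(ℝ, EB) 𝓑.proj p v) := by
  have hp' := mem_coord_source.1 hp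
  have h1 : HasMFDerivAt 𝓘(ℝ, EP) 𝓘(ℝ, EB) (chartAt EB b ∘ 𝓑.proj) p
      ((mfderiv 𝓘(ℝ, EB) 𝓘(ℝ, EB) (chartAt EB b) (𝓑.proj p)).comp
        (mfderiv 𝓘(ℝ, EP) 𝓘(ℝ, EB) 𝓑.proj p)) :=
    HasMFDerivAt.comp p (mdifferentiableAt_atlas (chart_mem_atlas _ _) hp'.2.1).hasMFDerivAt
      (𝓑.mdifferentiableAt_proj p).hasMFDerivAt
  have h2 : HasMFDerivAt 𝓘(ℝ, EP) 𝓘(ℝ, EB) (Prod.fst ∘ T.coord b g) p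
      ((ContinuousLinearMap.fst ℝ EB EG).comp
        (mfderiv 𝓘(ℝ, EP) 𝓘(ℝ, EB × EG) (T.coord b g) p)) :=
    HasMFDerivAt.comp p (hasMFDerivAt_iff_hasFDerivAt.2 hasFDerivAt_fst)
      (mdifferentiable_coord.mdifferentiableAt hp).hasMFDerivAt
  have h3 : (chartAt EB b ∘ 𝓑.proj) =ᶠ[𝓝 p] (Prod.fst ∘ T.coord b g) := by
    filter_upwards [(T.coord b g).open_source.mem_nhds hp] with q hq
    simp only [Function.comp, coord_apply (mem_coord_source.1 hq).1]
  have h4 := hasMFDerivAt_unique (h2.congr_of_eventuallyEq h3) h1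
  exact congrArg (fun L : EP →L[ℝ] EB => L v) h4

/-- The first component of a bundle chart factors through the projection followed by a chart of the
base, whose derivative is injective. -/
theorem mfderiv_proj_eq_zero_iff {p : P} (hp : p ∈ (T.coord b g).source)
    (v : TangentSpace 𝓘(ℝ, EP) p) :
    mfderiv 𝓘(ℝ, EP) 𝓘(ℝ, EB) 𝓑.proj p v = 0 ↔
      (mfderiv 𝓘(ℝ, EP) 𝓘(ℝ, EB × EG) (T.coord b g) p v).1 = 0 := by
  rw [mfderiv_coord_fst hp]
  refine ⟨fun h => by rw [h]; exact map_zero _, fun h => ?_⟩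
  have hinj := (mdifferentiable_chart (I := 𝓘(ℝ, EB)) b).mfderiv_injective
    (mem_coord_source.1 hp).2.1
  exact hinj (h.trans (map_zero _).symm)

end Triv

/-! ### Connection coefficients in bundle charts -/

namespace ConnectionForm

variable [IsManifold 𝓘(ℝ, EP) ∞ P] (Φ : 𝓑.ConnectionForm)

/-- Horizontal vectors over the same base vector are equal. -/
theorem eq_of_horizontal {p : P} {v w : TangentSpace 𝓘(ℝ, EP) p} (hv : Φ.Θ p v = 0)
    (hw : Φ.Θ p w = 0) (h : mfderiv 𝓘(ℝ, EP) 𝓘(ℝ, EB) 𝓑.proj p v =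
      mfderiv 𝓘(ℝ, EP) 𝓘(ℝ, EB) 𝓑.proj p w) : v = w := by
  have h1 : Φ.Θ p (v - w) = v - w := Φ.eq_self p _ (by rw [map_sub, h, sub_self])
  rw [map_sub, hv, hw, sub_zero] at h1
  exact (sub_eq_zero.1 h1.symm)

/-- The Christoffel form of the connection in a bundle chart: horizontal vectors are of the form
`(v, A v)`. -/
def christoffel (T : 𝓑.Triv) (b : B) (g : G) (z : EB × EG) : EB →L[ℝ] EG :=
  -((ContinuousLinearMap.snd ℝ EB EG).comp
    ((mfderiv 𝓘(ℝ, EP) 𝓘(ℝ, EB × EG) (T.coord b g) ((T.coord b g).symm z) : EP →L[ℝ] EB × EG).comp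
      ((Φ.Θ ((T.coord b g).symm z) : EP →L[ℝ] EP).comp
        ((mfderiv 𝓘(ℝ, EB × EG) 𝓘(ℝ, EP) (T.coord b g).symm z : EB × EG →L[ℝ] EP).comp
          (ContinuousLinearMap.inl ℝ EB EG)))))

variable [IsManifold 𝓘(ℝ, EB) ∞ B] [IsManifold 𝓘(ℝ, EG) ∞ G]

/-- As `EB` is finite dimensional, smoothness of an operator-valued map can be tested on single
vectors. -/
theorem contDiffOn_christoffel [FiniteDimensional ℝ EB] (T : 𝓑.Triv) (b : B) (g : G) :
    ContDiffOn ℝ ∞ (Φ.christoffel T b g) (T.coord b g).target := by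
  refine contDiffOn_clm_apply.2 fun v => ?_
  have := contDiffOn_endomorphism_apply Φ.smooth Triv.contMDiffOn_coord
    (Triv.contMDiffOn_coord_symm (T := T) (b := b) (g := g)) ((v, 0) : EB × EG)
  exact (contDiff_snd.comp_contDiffOn this).neg

/-- In the chart Θ is (v, w) ↦ (0, w - A v), A being the Christoffel form: its values are vertical,
and it fixes vertical vectors. -/
theorem Θ_eq_zero_iff {T : 𝓑.Triv} {b : B} {g : G} {p : P} (hp : p ∈ (T.coord b g).source)
    (v : TangentSpace 𝓘(ℝ, EP) p) :
    Φ.Θ p v = 0 ↔ (mfderiv 𝓘(ℝ, EP) 𝓘(ℝ, EB × EG) (T.coord b g) p v).2 =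
      Φ.christoffel T b g (T.coord b g p)
        (mfderiv 𝓘(ℝ, EP) 𝓘(ℝ, EB × EG) (T.coord b g) p v).1 := by
  obtain ⟨z, hz, rfl⟩ : ∃ z ∈ (T.coord b g).target, p = (T.coord b g).symm z :=
    ⟨_, (T.coord b g).map_source hp, ((T.coord b g).left_inv hp).symm⟩
  rw [(T.coord b g).right_inv hz]
  set e := T.coord b g with he
  set D : EP →L[ℝ] EB × EG := mfderiv 𝓘(ℝ, EP) 𝓘(ℝ, EB × EG) e (e.symm z) with hD
  set D' : EB × EG →L[ℝ] EP := mfderiv 𝓘(ℝ, EB × EG) 𝓘(ℝ, EP) e.symm z with hD'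
  set K : EP →L[ℝ] EP := Φ.Θ (e.symm z) with hK
  have hDD' : ∀ w, D (D' w) = w := fun w =>
    congrArg (fun L : EB × EG →L[ℝ] EB × EG => L w) (Triv.mdifferentiable_coord.comp_symm_deriv hz)
  have hinj : Function.Injective D := Triv.mdifferentiable_coord.mfderiv_injective hp
  have hD'D : ∀ w, D' (D w) = w := fun w => hinj (hDD' (D w))
  have hvert : ∀ w, (D (K w)).1 = 0 := fun w =>
    (Triv.mfderiv_proj_eq_zero_iff hp _).1 (Φ.vertical _ w)
  have hid : ∀ w, (D w).1 = 0 → K w = w := fun w hw =>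
    Φ.eq_self _ w ((Triv.mfderiv_proj_eq_zero_iff hp _).2 hw)
  have hA : ∀ x, Φ.christoffel T b g z x = -(D (K (D' (x, 0)))).2 := fun x => rfl
  have key : ∀ v, D (K v) = (0, (D v).2 - Φ.christoffel T b g z (D v).1) := by
    intro v
    have h1 : v = D' ((D v).1, 0) + D' (0, (D v).2) := by
      rw [← map_add, Prod.mk_add_mk, add_zero, zero_add, Prod.mk.eta, hD'D]
    have h2 : K (D' (0, (D v).2)) = D' (0, (D v).2) := hid _ (by rw [hDD'])
    have h3 : D (K v) = D (K (D' ((D v).1, 0))) + (0, (D v).2) := by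
      conv_lhs => rw [h1]
      rw [map_add, h2, map_add, hDD']
    refine Prod.ext (hvert v) ?_
    rw [h3, hA]
    simp only [Prod.snd_add]
    abel
  suffices h : ∀ v, K v = 0 ↔ (D v).2 = Φ.christoffel T b g z (D v).1 from h _
  intro v
  rw [← hinj.eq_iff, key, map_zero, Prod.mk_eq_zero, sub_eq_zero]
  simp

end ConnectionForm

/-! ### Horizontal lifts -/

namespace ConnectionForm

variable [IsManifold 𝓘(ℝ, EP) ∞ P] (Φ : 𝓑.ConnectionForm)

/-- The curve `c` is at time `t` a smooth horizontal lift of the curve `γ`. -/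
def IsLiftAt (γ : ℝ → B) (c : ℝ → P) (t : ℝ) : Prop :=
  ContMDiffAt 𝓘(ℝ, ℝ) 𝓘(ℝ, EP) ∞ c t ∧ 𝓑.proj (c t) = γ t ∧
    (⟨c t, mfderiv 𝓘(ℝ, ℝ) 𝓘(ℝ, EP) c t (1 : ℝ)⟩ : TangentBundle 𝓘(ℝ, EP) P) ∈ Φ.horizontal

variable {Φ} {γ : ℝ → B} {c : ℝ → P} {t : ℝ}

theorem IsLiftAt.mdifferentiableAt (h : Φ.IsLiftAt γ c t) :
    MDifferentiableAt 𝓘(ℝ, ℝ) 𝓘(ℝ, EP) c t :=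
  h.1.mdifferentiableAt (by simp)

theorem IsLiftAt.congr {c' : ℝ → P} (hcc' : c =ᶠ[𝓝 t] c') (h : Φ.IsLiftAt γ c t) :
    Φ.IsLiftAt γ c' t := by
  refine ⟨h.1.congr_of_eventuallyEq hcc'.symm, by rw [← hcc'.self_of_nhds]; exact h.2.1, ?_⟩
  convert h.2.2 using 1
  exact tangentBundle_mk_eq hcc'.self_of_nhds.symm
    (congrArg (fun L : ℝ →L[ℝ] EP => L 1) hcc'.symm.mfderiv_eq)

variable [IsManifold 𝓘(ℝ, EB) ∞ B] [IsManifold 𝓘(ℝ, EG) ∞ G]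

variable (Φ) in
/-- The right-hand side of the differential equation for the `G`-component of a horizontal lift of
`γ` in a bundle chart. -/
def liftField (T : 𝓑.Triv) (b : B) (g : G) (γ : ℝ → B) (q : ℝ × EG) : EG :=
  Φ.christoffel T b g (chartAt EB b (γ q.1), q.2) (deriv (chartAt EB b ∘ γ) q.1)

omit [IsManifold 𝓘(ℝ, EP) ∞ P] [IsManifold 𝓘(ℝ, EG) ∞ G] in
theorem contDiffOn_chart_comp {J : Set ℝ} (hγ : ContMDiffOn 𝓘(ℝ, ℝ) 𝓘(ℝ, EB) ∞ γ J)
    (T : 𝓑.Triv) (b : B) :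
    ContDiffOn ℝ ∞ (chartAt EB b ∘ γ) (J ∩ γ ⁻¹' (T.O ∩ (chartAt EB b).source)) :=
  contMDiffOn_iff_contDiffOn.1
    (contMDiffOn_chart.comp (hγ.mono inter_subset_left) fun _ ht => ht.2.2)

theorem contDiffOn_liftField [FiniteDimensional ℝ EB] {J : Set ℝ} (hJ : IsOpen J)
    (hγ : ContMDiffOn 𝓘(ℝ, ℝ) 𝓘(ℝ, EB) ∞ γ J) (T : 𝓑.Triv) (b : B) (g : G) :
    ContDiffOn ℝ ∞ (Φ.liftField T b g γ)
      ((J ∩ γ ⁻¹' (T.O ∩ (chartAt EB b).source)) ×ˢ (chartAt EG g).target) := by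
  have ho : IsOpen (J ∩ γ ⁻¹' (T.O ∩ (chartAt EB b).source)) :=
    hγ.continuousOn.isOpen_inter_preimage hJ (T.isOpen_O.inter (chartAt EB b).open_source)
  have hx := contDiffOn_chart_comp hγ T b
  have hx' := hx.deriv_of_isOpen (m := ∞) ho le_rfl
  refine ContDiffOn.clm_apply ((Φ.contDiffOn_christoffel T b g).comp (f := fun q : ℝ × EG =>
      (chartAt EB b (γ q.1), q.2))
    ((hx.comp contDiff_fst.contDiffOn fun q hq => hq.1).prodMk contDiff_snd.contDiffOn) ?_)
    (hx'.comp contDiff_fst.contDiffOn fun q hq => hq.1)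
  rintro ⟨t, y⟩ ⟨ht, hy⟩
  refine Triv.mem_coord_target.2 ?_
  refine ⟨(chartAt EB b).map_source ht.2.2, ?_, hy⟩
  change (chartAt EB b).symm (chartAt EB b (γ t)) ∈ T.O
  rw [(chartAt EB b).left_inv ht.2.2]
  exact ht.2.1

/-- In a bundle chart the velocity of the lift is (x', y') with x the coordinate expression of γ,
and horizontality says y' = A x'. Lying over γ is needed near `t`, not only at `t`, in order to
identify x'. -/
theorem IsLiftAt.hasDerivAt_coord_snd (h : Φ.IsLiftAt γ c t)
    (hp : ∀ᶠ u in 𝓝 t, 𝓑.proj (c u) = γ u) {T : 𝓑.Triv} {b : B} {g : G}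
    (hc : c t ∈ (T.coord b g).source) :
    HasDerivAt (fun u => chartAt EG g (T.τ (c u)).2)
      (Φ.liftField T b g γ (t, chartAt EG g (T.τ (c t)).2)) t := by
  have hmem := Triv.mem_coord_source.1 hc
  have hd := hasDerivAt_comp_curve (Triv.mdifferentiable_coord.mdifferentiableAt hc)
    h.mdifferentiableAt
  have hev : ∀ᶠ u in 𝓝 t, T.coord b g (c u) = (chartAt EB b (γ u), chartAt EG g (T.τ (c u)).2) := by
    filter_upwards [h.1.continuousAt.eventually_mem ((T.coord b g).open_source.mem_nhds hc), hp]
      with u hu hpu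
    rw [Triv.coord_apply (Triv.mem_coord_source.1 hu).1, hpu]
  have hd' := hd.congr_of_eventuallyEq (EventuallyEq.symm hev)
  have h1 := (hasFDerivAt_fst (𝕜 := ℝ) (E := EB) (F := EG)).comp_hasDerivAt t hd'
  have h2 := (hasFDerivAt_snd (𝕜 := ℝ) (E := EB) (F := EG)).comp_hasDerivAt t hd'
  have h3 := (Φ.Θ_eq_zero_iff hc _).1 h.2.2
  have h4 : deriv (chartAt EB b ∘ γ) t =
      (mfderiv 𝓘(ℝ, EP) 𝓘(ℝ, EB × EG) (T.coord b g) (c t)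
        (mfderiv 𝓘(ℝ, ℝ) 𝓘(ℝ, EP) c t (1 : ℝ))).1 := h1.deriv
  rw [liftField, h4, ← hev.self_of_nhds, ← h3]
  exact h2

/-- Local uniqueness of horizontal lifts. -/
theorem eventuallyEq_of_isLiftAt [FiniteDimensional ℝ EB] {J : Set ℝ} (hJ : IsOpen J)
    (hγ : ContMDiffOn 𝓘(ℝ, ℝ) 𝓘(ℝ, EB) ∞ γ J) (ht : t ∈ J) {c₁ c₂ : ℝ → P}
    (h₁ : ∀ᶠ u in 𝓝 t, Φ.IsLiftAt γ c₁ u) (h₂ : ∀ᶠ u in 𝓝 t, Φ.IsLiftAt γ c₂ u)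
    (heq : c₁ t = c₂ t) : c₁ =ᶠ[𝓝 t] c₂ := by
  obtain ⟨T, hT⟩ : ∃ T : 𝓑.Triv, γ t ∈ T.O := 𝓑.locally_trivial (γ t)
  set g := (T.τ (c₁ t)).2 with hg
  set b := γ t with hb
  have hs : c₁ t ∈ (T.coord b g).source := by
    rw [Triv.mem_coord_source, h₁.self_of_nhds.2.1]
    exact ⟨hT, mem_chart_source _ _, mem_chart_source _ _⟩
  have key : ∀ c : ℝ → P, (∀ᶠ u in 𝓝 t, Φ.IsLiftAt γ c u) → c t = c₁ t →
      ∀ᶠ u in 𝓝 t, c u ∈ (T.coord b g).source ∧ HasDerivAt (fun u => chartAt EG g (T.τ (c u)).2)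
      (Φ.liftField T b g γ (u, chartAt EG g (T.τ (c u)).2)) u := by
    intro c h hc
    have hs' : ∀ᶠ u in 𝓝 t, c u ∈ (T.coord b g).source :=
      h.self_of_nhds.1.continuousAt.eventually_mem
        ((T.coord b g).open_source.mem_nhds (by rw [hc]; exact hs))
    filter_upwards [h.eventually_nhds, hs'] with u hu hsu
    exact ⟨hsu, hu.self_of_nhds.hasDerivAt_coord_snd (hu.mono fun v hv => hv.2.1) hsu⟩
  have k₁ := key c₁ h₁ rfl
  have k₂ := key c₂ h₂ heq.symm
  have hU : ((J ∩ γ ⁻¹' (T.O ∩ (chartAt EB b).source)) ×ˢ (chartAt EG g).target) ∈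
      𝓝 (t, chartAt EG g (T.τ (c₁ t)).2) := by
    refine (IsOpen.prod (hγ.continuousOn.isOpen_inter_preimage hJ
      (T.isOpen_O.inter (chartAt EB b).open_source)) (chartAt EG g).open_target).mem_nhds ?_
    exact ⟨⟨ht, hT, mem_chart_source _ _⟩, mem_chart_target _ _⟩
  have hy := eventuallyEq_of_hasDerivAt (y₁ := fun u => chartAt EG g (T.τ (c₁ u)).2)
    (y₂ := fun u => chartAt EG g (T.τ (c₂ u)).2)
    (((contDiffOn_liftField (Φ := Φ) hJ hγ T b g).contDiffAt hU).of_le (by exact_mod_cast le_top))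
    (k₁.mono fun u hu => hu.2) (k₂.mono fun u hu => hu.2) (by simp only [heq])
  filter_upwards [hy, k₁, k₂, h₁, h₂] with u hyu hu₁ hu₂ hl₁ hl₂
  refine (T.coord b g).injOn hu₁.1 hu₂.1 ?_
  rw [Triv.coord_apply (Triv.mem_coord_source.1 hu₁.1).1,
    Triv.coord_apply (Triv.mem_coord_source.1 hu₂.1).1, hyu, hl₁.2.1, hl₂.2.1]

/-- Horizontal lifts starting near a given point exist for a uniform time. -/
theorem exists_isLiftAt_nhds [FiniteDimensional ℝ EB] [FiniteDimensional ℝ EG] {J : Set ℝ}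
    (hJ : IsOpen J) (hγ : ContMDiffOn 𝓘(ℝ, ℝ) 𝓘(ℝ, EB) ∞ γ J) {t₀ : ℝ} (ht₀ : t₀ ∈ J) {T : 𝓑.Triv}
    (hT : γ t₀ ∈ T.O) (g : G) :
    ∃ ε > 0, ∃ N ∈ 𝓝 g, ∀ τ ∈ Ioo (t₀ - ε) (t₀ + ε), ∀ h ∈ N,
      ∃ c : ℝ → P, c τ = T.τ.symm (γ τ, h) ∧ ∀ t ∈ Ioo (t₀ - ε) (t₀ + ε), Φ.IsLiftAt γ c t := by
  set b := γ t₀ with hb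
  set J' := J ∩ γ ⁻¹' (T.O ∩ (chartAt EB b).source) with hJ'
  have ho : IsOpen J' :=
    hγ.continuousOn.isOpen_inter_preimage hJ (T.isOpen_O.inter (chartAt EB b).open_source)
  have hx : ContDiffOn ℝ ∞ (chartAt EB b ∘ γ) J' := contDiffOn_chart_comp hγ T b
  have h0 : (t₀, chartAt EG g g) ∈ J' ×ˢ (chartAt EG g).target :=
    ⟨⟨ht₀, hT, mem_chart_source _ _⟩, mem_chart_target _ _⟩
  obtain ⟨ε, hε, r, hr, H⟩ := exists_uniform_hasDerivAt (ho.prod (chartAt EG g).open_target)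
    (contDiffOn_liftField (Φ := Φ) hJ hγ T b g) h0
  refine ⟨ε, hε, (chartAt EG g).source ∩ chartAt EG g ⁻¹' Metric.closedBall (chartAt EG g g) r,
    inter_mem (chart_source_mem_nhds _ _) (((chartAt EG g).continuousAt (mem_chart_source _ _)).preimage_mem_nhds
      (Metric.closedBall_mem_nhds _ hr)), fun τ hτ h hh => ?_⟩
  obtain ⟨α, hατ, hα, hαt⟩ := H τ hτ _ hh.2
  have hz : ∀ t ∈ Ioo (t₀ - ε) (t₀ + ε), (chartAt EB b (γ t), α t) ∈ (T.coord b g).target := by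
    intro t ht
    have h1 := (hαt t ht).1
    rw [Triv.mem_coord_target, (chartAt EB b).left_inv h1.1.2.2]
    exact ⟨(chartAt EB b).map_source h1.1.2.2, h1.1.2.1, h1.2⟩
  have hsm : ContMDiffOn 𝓘(ℝ, ℝ) 𝓘(ℝ, EP) ∞
      (fun t => (T.coord b g).symm (chartAt EB b (γ t), α t)) (Ioo (t₀ - ε) (t₀ + ε)) :=
    Triv.contMDiffOn_coord_symm.comp
      ((hx.mono fun t ht => (hαt t ht).1.1).prodMk hα).contMDiffOn hz
  refine ⟨fun t => (T.coord b g).symm (chartAt EB b (γ t), α t), ?_, fun t ht => ?_⟩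
  · simp only [Triv.coord_symm_apply, hατ, (chartAt EG g).left_inv hh.1,
      (chartAt EB b).left_inv (hαt τ hτ).1.1.2.2]
  have hsmt := hsm.contMDiffAt (isOpen_Ioo.mem_nhds ht)
  refine ⟨hsmt, ?_, ?_⟩
  · have h1 := (hαt t ht).1
    simp only [Triv.coord_symm_apply, (chartAt EB b).left_inv h1.1.2.2]
    exact (T.map_symm h1.1.2.1 _).1
  · have hs := (T.coord b g).map_target (hz t ht)
    refine (Φ.Θ_eq_zero_iff hs _).2 ?_
    have hd := hasDerivAt_comp_curve (c := fun t => (T.coord b g).symm (chartAt EB b (γ t), α t))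
      (Triv.mdifferentiable_coord.mdifferentiableAt hs) (hsmt.mdifferentiableAt (by simp))
    have hd' : HasDerivAt (fun t => (chartAt EB b (γ t), α t))
        (deriv (chartAt EB b ∘ γ) t, Φ.liftField T b g γ (t, α t)) t :=
      (((hx.differentiableOn (by simp)).differentiableAt
        (ho.mem_nhds (hαt t ht).1.1)).hasDerivAt).prodMk (hαt t ht).2
    have hd'' := hd.unique (hd'.congr_of_eventuallyEq (by
      filter_upwards [isOpen_Ioo.mem_nhds ht] with u hu using (T.coord b g).right_inv (hz u hu)))
    -- The velocity is abstracted to `W` so that it can be replaced as a whole by the known pair.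
    have h5 : ∀ W : EB × EG, W = (deriv (chartAt EB b ∘ γ) t, Φ.liftField T b g γ (t, α t)) →
        W.2 = Φ.christoffel T b g
          (T.coord b g ((T.coord b g).symm (chartAt EB b (γ t), α t))) W.1 := by
      rintro _ rfl
      rw [(T.coord b g).right_inv (hz t ht)]
      rfl
    exact h5 _ hd''

end ConnectionForm

/-- This reduces lifts through `p` to lifts through the point over the unit at the shadow of `p`. -/
theorem Triv.act_symm_one (T : 𝓑.Triv) {p : P} (hp : 𝓑.proj p ∈ T.O) :
    𝓑.act (T.τ.symm (𝓑.proj p, Γ.one (Γ.t (T.τ p).2))) (T.τ p).2 = p := by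
  rw [← T.symm_eq hp, ← T.fst_apply p hp, Prod.mk.eta, T.τ.left_inv (by rw [T.source_eq]; exact hp)]

namespace ConnectionForm

variable [IsManifold 𝓘(ℝ, EP) ∞ P] {Φ : 𝓑.ConnectionForm} {γ : ℝ → B} {c : ℝ → P} {t : ℝ}

/-! ### Translation of horizontal lifts by the groupoid -/

/-- T μ = T μ ∘ Θ, and Θ annihilates the velocity of the lift. -/
theorem IsLiftAt.hasMFDerivAt_moment (h : Φ.IsLiftAt γ c t) :
    HasMFDerivAt 𝓘(ℝ, ℝ) 𝓘(ℝ, EM) (𝓑.μ ∘ c) t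
      (0 : TangentSpace 𝓘(ℝ, ℝ) t →L[ℝ] TangentSpace 𝓘(ℝ, EM) (𝓑.μ (c t))) := by
  have h1 := ((𝓑.smooth_μ.mdifferentiable (by simp)) (c t)).hasMFDerivAt.comp t
    h.mdifferentiableAt.hasMFDerivAt
  convert h1 using 1
  refine ContinuousLinearMap.ext_ring (R₁ := ℝ) ?_
  have h2 := Φ.moment (c t) (mfderiv 𝓘(ℝ, ℝ) 𝓘(ℝ, EP) c t (1 : ℝ))
  have h3 : Φ.Θ (c t) (mfderiv 𝓘(ℝ, ℝ) 𝓘(ℝ, EP) c t (1 : ℝ)) = 0 := h.2.2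
  rw [h3, map_zero] at h2
  exact h2

/-- The moment map is constant along horizontal lifts. -/
theorem moment_eq_of_isLiftAt [IsManifold 𝓘(ℝ, EM) ∞ M] [T2Space M] {I : Set ℝ} (hI : IsOpen I)
    (hc : I.OrdConnected) (h : ∀ t ∈ I, Φ.IsLiftAt γ c t) {s t : ℝ} (hs : s ∈ I) (ht : t ∈ I) :
    𝓑.μ (c t) = 𝓑.μ (c s) := by
  have hcont : ∀ u ∈ I, ContinuousAt (𝓑.μ ∘ c) u := fun u hu =>
    (h u hu).hasMFDerivAt_moment.continuousAt
  refine eqOn_of_forall_eventuallyEq (c₁ := 𝓑.μ ∘ c) (c₂ := fun _ => 𝓑.μ (c s)) hI hc.isPreconnected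
    (fun u hu => (hcont u hu).continuousWithinAt) continuousOn_const ?_ hs rfl ht
  intro u hu hus
  set m := 𝓑.μ (c s) with hm
  have hsrc : ∀ᶠ v in 𝓝 u, v ∈ I ∧ (𝓑.μ ∘ c) v ∈ (chartAt EM m).source := by
    refine (hI.eventually_mem hu).and ((hcont u hu).eventually_mem ?_)
    rw [hus]
    exact chart_source_mem_nhds _ _
  have hder : ∀ᶠ v in 𝓝 u, HasDerivAt (chartAt EM m ∘ 𝓑.μ ∘ c) (0 : EM) v := by
    filter_upwards [hsrc] with v hv
    have h1 := (mdifferentiableAt_atlas (I := 𝓘(ℝ, EM)) (chart_mem_atlas EM m) hv.2).hasMFDerivAt.comp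
      v (h v hv.1).hasMFDerivAt_moment
    rw [ContinuousLinearMap.comp_zero] at h1
    have h2 : HasFDerivAt (chartAt EM m ∘ 𝓑.μ ∘ c) (0 : ℝ →L[ℝ] EM) v :=
      hasMFDerivAt_iff_hasFDerivAt.1 h1
    exact h2.hasDerivAt
  -- In a chart both curves solve y' = 0.
  have hev := eventuallyEq_of_hasDerivAt (f := fun _ : ℝ × EM => (0 : EM))
    (y₁ := chartAt EM m ∘ 𝓑.μ ∘ c) (y₂ := fun _ => chartAt EM m m) contDiffAt_const hder
    (Eventually.of_forall fun v => hasDerivAt_const _ _) (congrArg (chartAt EM m) hus)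
  filter_upwards [hev, hsrc] with v hv hv'
  exact (chartAt EM m).injOn hv'.2 (mem_chart_source _ _) hv

/-- Translation by `g` is smooth only within a fibre of μ. The curve stays in that fibre near `t`,
so the derivative within the fibre computes the velocity of the translated curve, and invariance of
ker Θ makes it horizontal. -/
theorem IsLiftAt.act (h : Φ.IsLiftAt γ c t) {g : G} (hg : ∀ᶠ u in 𝓝 t, 𝓑.μ (c u) = Γ.t g) :
    Φ.IsLiftAt γ (fun u => 𝓑.act (c u) g) t := by
  have hs : {u | 𝓑.μ (c u) = Γ.t g} ∈ 𝓝 t := hg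
  have hsm : ContMDiffWithinAt 𝓘(ℝ, EP) 𝓘(ℝ, EP) ∞ (fun q => 𝓑.act q g) {q | 𝓑.μ q = Γ.t g}
      (c t) :=
    (𝓑.smooth_act (c t, g) hg.self_of_nhds).comp (f := fun q : P => (q, g)) (c t)
      (contMDiff_id.prodMk contMDiff_const).contMDiffAt.contMDiffWithinAt fun q hq => hq
  have hder : HasMFDerivAt 𝓘(ℝ, ℝ) 𝓘(ℝ, EP) (fun u => 𝓑.act (c u) g) t
      ((𝓑.tangentAct g (c t)).comp (mfderiv 𝓘(ℝ, ℝ) 𝓘(ℝ, EP) c t)) :=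
    ((hsm.mdifferentiableWithinAt (by simp)).hasMFDerivWithinAt.comp t
      h.mdifferentiableAt.hasMFDerivAt.hasMFDerivWithinAt fun u hu => hu).hasMFDerivAt hs
  refine ⟨(hsm.comp t h.1.contMDiffWithinAt fun u hu => hu).contMDiffAt hs, ?_, ?_⟩
  · rw [𝓑.proj_act _ _ hg.self_of_nhds, h.2.1]
  · have h1 : 𝓑.tangentAct g (c t) (mfderiv 𝓘(ℝ, ℝ) 𝓘(ℝ, EP) c t (1 : ℝ)) ∈
        {w | Φ.Θ (𝓑.act (c t) g) w = 0} := by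
      rw [← Φ.invariant g (c t) hg.self_of_nhds]
      exact mem_image_of_mem _ h.2.2
    rw [hder.mfderiv]
    exact h1

/-! ### Global lifts, and completeness for compact `M` -/

variable [IsManifold 𝓘(ℝ, EB) ∞ B] [IsManifold 𝓘(ℝ, EG) ∞ G] [FiniteDimensional ℝ EB]

/-- Horizontal lifts exist globally if they exist for a locally uniform time. -/
theorem exists_global_isLiftAt [T2Space P] {J : Set ℝ} (hJ : IsOpen J) (hJc : J.OrdConnected)
    (hγ : ContMDiffOn 𝓘(ℝ, ℝ) 𝓘(ℝ, EB) ∞ γ J) {Q : ℝ → P → Prop}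
    (hex : ∀ τ₀ ∈ J, ∃ I : Set ℝ, IsOpen I ∧ I.OrdConnected ∧ τ₀ ∈ I ∧ I ⊆ J ∧
      ∀ τ ∈ I, ∀ p, 𝓑.proj p = γ τ → Q τ p →
        ∃ c : ℝ → P, c τ = p ∧ ∀ t ∈ I, Φ.IsLiftAt γ c t ∧ Q t (c t))
    {t₀ : ℝ} (ht₀ : t₀ ∈ J) {p₀ : P} (hp₀ : 𝓑.proj p₀ = γ t₀) (hQ : Q t₀ p₀) :
    ∃ c : ℝ → P, ContMDiffOn 𝓘(ℝ, ℝ) 𝓘(ℝ, EP) ∞ c J ∧ c t₀ = p₀ ∧ ∀ t ∈ J, 𝓑.proj (c t) = γ t ∧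
      (⟨c t, mfderiv 𝓘(ℝ, ℝ) 𝓘(ℝ, EP) c t (1 : ℝ)⟩ : TangentBundle 𝓘(ℝ, EP) P) ∈ Φ.horizontal := by
  -- The constraint `Q` is part of the problem being solved, so that it is available at each
  -- restart.
  obtain ⟨c, hc0, hc⟩ := exists_global_of_local (S := fun c t => Φ.IsLiftAt γ c t ∧ Q t (c t))
    (Q := fun t p => 𝓑.proj p = γ t ∧ Q t p) hJc
    (fun {c₁ c₂ t} hcc h => ⟨h.1.congr hcc, by rw [← hcc.self_of_nhds]; exact h.2⟩)
    (fun {c t} h => h.1.1.continuousAt) (fun {c t} h => ⟨h.1.2.1, h.2⟩)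
    (fun c₁ c₂ t ht h₁ h₂ heq => eventuallyEq_of_isLiftAt hJ hγ ht (h₁.mono fun u hu => hu.1)
      (h₂.mono fun u hu => hu.1) heq)
    (fun τ₀ hτ₀ => by
      obtain ⟨I, ho, hI, h0, hIJ, H⟩ := hex τ₀ hτ₀
      exact ⟨I, ho, hI, h0, hIJ, fun τ hτ p hp => H τ hτ p hp.1 hp.2⟩)
    ht₀ ⟨hp₀, hQ⟩
  exact ⟨c, fun t ht => (hc t ht).1.1.contMDiffWithinAt, hc0, fun t ht => (hc t ht).1.2⟩

variable [IsManifold 𝓘(ℝ, EM) ∞ M] [T2Space M] [FiniteDimensional ℝ EG]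

/-- Horizontal lifts exist for a time that is uniform in the initial time and in all initial points
whose shadow is close to a given one. -/
theorem exists_isLiftAt_of_shadow_nhds {J : Set ℝ} (hJ : IsOpen J)
    (hγ : ContMDiffOn 𝓘(ℝ, ℝ) 𝓘(ℝ, EB) ∞ γ J) {t₀ : ℝ} (ht₀ : t₀ ∈ J) {T : 𝓑.Triv}
    (hT : γ t₀ ∈ T.O) (m : M) :
    ∃ ε > 0, ∃ N ∈ 𝓝 m, ∀ τ ∈ Ioo (t₀ - ε) (t₀ + ε), γ τ ∈ T.O → ∀ p : P, 𝓑.proj p = γ τ →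
      Γ.t (T.τ p).2 ∈ N →
      ∃ c : ℝ → P, c τ = p ∧ ∀ t ∈ Ioo (t₀ - ε) (t₀ + ε), Φ.IsLiftAt γ c t := by
  -- The local theory is applied at the unit of `m` only; pulling `N` back along the unit map gives
  -- the neighbourhood of objects.
  obtain ⟨ε, hε, N, hN, H⟩ := exists_isLiftAt_nhds (Φ := Φ) hJ hγ ht₀ hT (Γ.one m)
  refine ⟨ε, hε, Γ.one ⁻¹' N, Γ.smooth_one.continuous.continuousAt.preimage_mem_nhds hN,
    fun τ hτ hτT p hp hpN => ?_⟩
  obtain ⟨c, hcτ, hc⟩ := H τ hτ _ hpN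
  -- Constancy of the moment map lets the arrow `(T.τ p).2` act along the whole lift, so translating
  -- it costs no time.
  have hμ : ∀ t ∈ Ioo (t₀ - ε) (t₀ + ε), 𝓑.μ (c t) = Γ.t (T.τ p).2 := by
    intro t ht
    rw [moment_eq_of_isLiftAt isOpen_Ioo ordConnected_Ioo hc hτ ht, hcτ, (T.map_symm hτT _).2.2,
      Γ.s_one]
  refine ⟨fun t => 𝓑.act (c t) (T.τ p).2, ?_, fun t ht => (hc t ht).act
    (mem_of_superset (isOpen_Ioo.mem_nhds ht) hμ)⟩
  simp only [hcτ, ← hp]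
  exact T.act_symm_one (by rw [hp]; exact hτT)

/-- Connections are complete if the manifold of objects is compact. -/
theorem isComplete_of_compactSpace [T2Space P] [CompactSpace M] (Φ : 𝓑.ConnectionForm) :
    Φ.IsComplete := by
  intro J γ hJ hJc hγ t₀ ht₀ p₀ hp₀
  refine exists_global_isLiftAt (Q := fun _ _ => True) hJ hJc hγ (fun τ₀ hτ₀ => ?_) ht₀ hp₀ trivial
  obtain ⟨T, hT⟩ : ∃ T : 𝓑.Triv, γ τ₀ ∈ T.O := 𝓑.locally_trivial (γ τ₀)
  choose ε hε N hN H using exists_isLiftAt_of_shadow_nhds (Φ := Φ) hJ hγ hτ₀ hT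
  obtain ⟨s, hs⟩ := CompactSpace.elim_nhds_subcover N hN
  have hU : J ∩ γ ⁻¹' T.O ∈ 𝓝 τ₀ :=
    (hγ.continuousOn.isOpen_inter_preimage hJ T.isOpen_O).mem_nhds ⟨hτ₀, hT⟩
  obtain ⟨δ, hδ, hδU⟩ := Metric.mem_nhds_iff.1 hU
  rw [Real.ball_eq_Ioo] at hδU
  -- A positive lower bound of finitely many positive numbers; phrased with filters, it also covers
  -- empty `s`.
  obtain ⟨r, hr, hr0⟩ : ∃ r : ℝ, (r ≤ δ ∧ ∀ m ∈ s, r ≤ ε m) ∧ 0 < r :=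
    ((((eventually_le_nhds hδ).and ((Filter.eventually_all_finset s).2
      fun m _ => eventually_le_nhds (hε m))).filter_mono nhdsWithin_le_nhds).and
        (self_mem_nhdsWithin (s := Ioi (0 : ℝ)))).exists
  have hsub : ∀ a, r ≤ a → Ioo (τ₀ - r) (τ₀ + r) ⊆ Ioo (τ₀ - a) (τ₀ + a) := fun a ha =>
    Ioo_subset_Ioo (by linarith) (by linarith)
  refine ⟨Ioo (τ₀ - r) (τ₀ + r), isOpen_Ioo, ordConnected_Ioo, ⟨by linarith, by linarith⟩,
    fun t ht => (hδU (hsub _ hr.1 ht)).1, fun τ hτ p hp _ => ?_⟩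
  have hm : Γ.t (T.τ p).2 ∈ ⋃ x ∈ s, N x := by rw [hs]; trivial
  obtain ⟨m, hms, hm⟩ := mem_iUnion₂.1 hm
  obtain ⟨c, hcτ, hc⟩ := H m τ (hsub _ (hr.2 m hms) hτ) (hδU (hsub _ hr.1 hτ)).2 p hp hm
  exact ⟨c, hcτ, fun t ht => ⟨hc t (hsub _ (hr.2 m hms) ht), trivial⟩⟩

end ConnectionForm

/-! ### Bundle charts of the shadow bundle -/

namespace Triv

/-- The chart of the shadow bundle given by a local trivialisation and charts of the base and of
the manifold of objects. -/
def shadowCoord (T : 𝓑.Triv) (b : B) (m : M) : OpenPartialHomeomorph 𝓑.Shadow (EB × EM) :=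
  (𝓑.shadowCore.localTriv T).toOpenPartialHomeomorph ≫ₕ (chartAt EB b).prod (chartAt EM m)

variable {T : 𝓑.Triv} {b : B} {m : M}

theorem shadowCoord_apply (f : 𝓑.Shadow) : T.shadowCoord b m f =
    (chartAt EB b (𝓑.shadowProj f), chartAt EM m (𝓑.shadowCore.localTriv T f).2) := rfl

theorem mem_shadowCoord_source {f : 𝓑.Shadow} : f ∈ (T.shadowCoord b m).source ↔
    𝓑.shadowProj f ∈ T.O ∧ 𝓑.shadowProj f ∈ (chartAt EB b).source ∧
      (𝓑.shadowCore.localTriv T f).2 ∈ (chartAt EM m).source := by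
  simp only [shadowCoord, OpenPartialHomeomorph.trans_source, mem_inter_iff, mem_preimage,
    OpenPartialHomeomorph.prod_source, mem_prod]
  exact and_congr (𝓑.shadowCore.mem_localTriv_source T f) Iff.rfl

theorem shadowCoord_duck {p : P} (hp : 𝓑.proj p ∈ T.O) : T.shadowCoord b m (𝓑.duck p) =
    (chartAt EB b (𝓑.proj p), chartAt EM m (Γ.t (T.τ p).2)) := by
  rw [shadowCoord_apply, 𝓑.localTriv_duck T p hp]
  rfl

theorem duck_mem_shadowCoord_source {p : P} (hp : 𝓑.proj p ∈ T.O) :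
    𝓑.duck p ∈ (T.shadowCoord b m).source ↔
      𝓑.proj p ∈ (chartAt EB b).source ∧ Γ.t (T.τ p).2 ∈ (chartAt EM m).source := by
  rw [mem_shadowCoord_source, 𝓑.localTriv_duck T p hp]
  exact and_iff_right hp

theorem contMDiffAt_t_comp {p : P} (hp : 𝓑.proj p ∈ T.O) :
    ContMDiffAt 𝓘(ℝ, EP) 𝓘(ℝ, EM) ∞ (fun q => Γ.t (T.τ q).2) p := by
  have h : ContMDiffAt 𝓘(ℝ, EP) (𝓘(ℝ, EB).prod 𝓘(ℝ, EG)) ∞ T.τ p :=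
    T.smooth.contMDiffAt (T.τ.open_source.mem_nhds (by rw [T.source_eq]; exact hp))
  exact Γ.submersion_t.contMDiff.contMDiffAt.comp p (contMDiff_snd.contMDiffAt.comp p h)

variable [IsManifold 𝓘(ℝ, EB) ∞ B] [IsManifold 𝓘(ℝ, EM) ∞ M]

/-- The atlas of the shadow bundle contains the charts built from every trivialisation, not only
from the preferred ones. -/
theorem shadowCoord_mem_maximalAtlas : (T.shadowCoord b m) ∈
    IsManifold.maximalAtlas (M := 𝓑.Shadow) (𝓘(ℝ, EB).prod 𝓘(ℝ, EM)) ∞ := by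
  refine IsManifold.subset_maximalAtlas ?_
  exact ⟨_, ⟨_, ⟨T, rfl⟩, rfl⟩, chartAt (ModelProd EB EM) ((b, m) : B × M), chart_mem_atlas _ _, rfl⟩

theorem contMDiffOn_shadowCoord : ContMDiffOn (𝓘(ℝ, EB).prod 𝓘(ℝ, EM)) 𝓘(ℝ, EB × EM) ∞
    (T.shadowCoord b m) (T.shadowCoord b m).source := by
  rw [modelWithCornersSelf_prod]
  exact contMDiffOn_of_mem_maximalAtlas shadowCoord_mem_maximalAtlas

theorem contMDiffOn_shadowCoord_symm : ContMDiffOn 𝓘(ℝ, EB × EM) (𝓘(ℝ, EB).prod 𝓘(ℝ, EM)) ∞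
    (T.shadowCoord b m).symm (T.shadowCoord b m).target := by
  rw [modelWithCornersSelf_prod]
  have h := contMDiffOn_symm_of_mem_maximalAtlas
    (shadowCoord_mem_maximalAtlas (T := T) (b := b) (m := m))
  exact h

theorem contMDiffAt_duck_coord {p : P} (hp : 𝓑.proj p ∈ T.O)
    (hpb : 𝓑.proj p ∈ (chartAt EB b).source) (hpm : Γ.t (T.τ p).2 ∈ (chartAt EM m).source) :
    ContMDiffAt 𝓘(ℝ, EP) 𝓘(ℝ, EB × EM) ∞
      (fun q => (chartAt EB b (𝓑.proj q), chartAt EM m (Γ.t (T.τ q).2))) p :=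
  ((contMDiffAt_of_mem_maximalAtlas (IsManifold.chart_mem_maximalAtlas b) hpb).comp p
    𝓑.submersion_proj.contMDiff.contMDiffAt).prodMk_space
    ((contMDiffAt_of_mem_maximalAtlas (IsManifold.chart_mem_maximalAtlas m) hpm).comp p
      (contMDiffAt_t_comp hp))

theorem mfderiv_duck_coord_fst {p : P} (hp : 𝓑.proj p ∈ T.O)
    (hpb : 𝓑.proj p ∈ (chartAt EB b).source) (hpm : Γ.t (T.τ p).2 ∈ (chartAt EM m).source)
    (v : TangentSpace 𝓘(ℝ, EP) p) :
    (mfderiv 𝓘(ℝ, EP) 𝓘(ℝ, EB × EM)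
      (fun q => (chartAt EB b (𝓑.proj q), chartAt EM m (Γ.t (T.τ q).2))) p v).1 =
      mfderiv 𝓘(ℝ, EB) 𝓘(ℝ, EB) (chartAt EB b) (𝓑.proj p)
        (mfderiv 𝓘(ℝ, EP) 𝓘(ℝ, EB) 𝓑.proj p v) := by
  have h1 : HasMFDerivAt 𝓘(ℝ, EP) 𝓘(ℝ, EB) (chartAt EB b ∘ 𝓑.proj) p
      ((mfderiv 𝓘(ℝ, EB) 𝓘(ℝ, EB) (chartAt EB b) (𝓑.proj p)).comp
        (mfderiv 𝓘(ℝ, EP) 𝓘(ℝ, EB) 𝓑.proj p)) :=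
    HasMFDerivAt.comp p (mdifferentiableAt_atlas (chart_mem_atlas _ _) hpb).hasMFDerivAt
      (𝓑.mdifferentiableAt_proj p).hasMFDerivAt
  have h2 : HasMFDerivAt 𝓘(ℝ, EP) 𝓘(ℝ, EB)
      (Prod.fst ∘ fun q => (chartAt EB b (𝓑.proj q), chartAt EM m (Γ.t (T.τ q).2))) p
      ((ContinuousLinearMap.fst ℝ EB EM).comp (mfderiv 𝓘(ℝ, EP) 𝓘(ℝ, EB × EM)
        (fun q => (chartAt EB b (𝓑.proj q), chartAt EM m (Γ.t (T.τ q).2))) p)) :=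
    HasMFDerivAt.comp p (hasMFDerivAt_iff_hasFDerivAt.2 hasFDerivAt_fst)
      ((contMDiffAt_duck_coord hp hpb hpm).mdifferentiableAt (by simp)).hasMFDerivAt
  exact congrArg (fun L : EP →L[ℝ] EB => L v) (hasMFDerivAt_unique h2 h1)

end Triv

/-- The sitting-duck map is smooth. -/
theorem contMDiffAt_duck (𝓑 : PrincipaloidBundle Γ EB EP B P) [IsManifold 𝓘(ℝ, EB) ∞ B] [IsManifold 𝓘(ℝ, EM) ∞ M] (p : P) :
    ContMDiffAt 𝓘(ℝ, EP) (𝓘(ℝ, EB).prod 𝓘(ℝ, EM)) ∞ 𝓑.duck p := by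
  obtain ⟨T, hT⟩ : ∃ T : 𝓑.Triv, 𝓑.proj p ∈ T.O := 𝓑.locally_trivial _
  set b := 𝓑.proj p
  set m := Γ.t (T.τ p).2
  have hs := (Triv.duck_mem_shadowCoord_source (b := b) (m := m) hT).2
    ⟨mem_chart_source _ _, mem_chart_source _ _⟩
  have h1 := Triv.contMDiffAt_duck_coord (b := b) (m := m) hT (mem_chart_source _ _)
    (mem_chart_source _ _)
  have h2 : ContMDiffAt 𝓘(ℝ, EB × EM) (𝓘(ℝ, EB).prod 𝓘(ℝ, EM)) ∞ (T.shadowCoord b m).symm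
      (chartAt EB b (𝓑.proj p), chartAt EM m (Γ.t (T.τ p).2)) := by
    refine Triv.contMDiffOn_shadowCoord_symm.contMDiffAt
      ((T.shadowCoord b m).open_target.mem_nhds ?_)
    rw [← Triv.shadowCoord_duck hT]
    exact (T.shadowCoord b m).map_source hs
  refine (h2.comp p h1).congr_of_eventuallyEq ?_
  have hO : ∀ᶠ q in 𝓝 p, 𝓑.proj q ∈ T.O :=
    𝓑.submersion_proj.contMDiff.continuous.continuousAt.eventually_mem (T.isOpen_O.mem_nhds hT)
  have hm : ∀ᶠ q in 𝓝 p, Γ.t (T.τ q).2 ∈ (chartAt EM m).source :=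
    (Triv.contMDiffAt_t_comp hT).continuousAt.eventually_mem (chart_source_mem_nhds _ _)
  have hb : ∀ᶠ q in 𝓝 p, 𝓑.proj q ∈ (chartAt EB b).source :=
    𝓑.submersion_proj.contMDiff.continuous.continuousAt.eventually_mem (chart_source_mem_nhds _ _)
  filter_upwards [hO, hm, hb] with q hq hqm hqb
  rw [Function.comp, ← Triv.shadowCoord_duck hq, (T.shadowCoord b m).left_inv
    ((Triv.duck_mem_shadowCoord_source hq).2 ⟨hqb, hqm⟩)]

/-! ### The differential equation of shadow lifts -/

namespace ConnectionForm

variable [IsManifold 𝓘(ℝ, EP) ∞ P] {Φ : 𝓑.ConnectionForm} {γ : ℝ → B} {t : ℝ}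

/-- The image of a horizontal lift in the shadow bundle is horizontal. -/
theorem IsLiftAt.duck [IsManifold 𝓘(ℝ, EB) ∞ B] [IsManifold 𝓘(ℝ, EM) ∞ M] {c : ℝ → P}
    (h : Φ.IsLiftAt γ c t) :
    (⟨𝓑.duck (c t), mfderiv 𝓘(ℝ, ℝ) (𝓘(ℝ, EB).prod 𝓘(ℝ, EM)) (𝓑.duck ∘ c) t (1 : ℝ)⟩ :
      TangentBundle (𝓘(ℝ, EB).prod 𝓘(ℝ, EM)) 𝓑.Shadow) ∈ Φ.shadowHorizontal := by
  refine ⟨_, h.2.2, ?_⟩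
  have h1 := mfderiv_comp_apply t ((𝓑.contMDiffAt_duck (c t)).mdifferentiableAt (by simp))
    h.mdifferentiableAt (1 : ℝ)
  exact tangentBundle_mk_eq rfl h1.symm

variable [IsManifold 𝓘(ℝ, EB) ∞ B] [IsManifold 𝓘(ℝ, EG) ∞ G] [IsManifold 𝓘(ℝ, EM) ∞ M]
  [FiniteDimensional ℝ EB] [FiniteDimensional ℝ EG]

/-- Every horizontal lift has locally the same shadow as one that starts at a unit. -/
theorem exists_isLiftAt_translate [T2Space M] {J : Set ℝ} (hJ : IsOpen J)
    (hγ : ContMDiffOn 𝓘(ℝ, ℝ) 𝓘(ℝ, EB) ∞ γ J) (ht : t ∈ J) {T : 𝓑.Triv} (hT : γ t ∈ T.O) {p : P}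
    (hp : 𝓑.proj p = γ t) :
    ∃ c c₀ : ℝ → P, c t = p ∧ (∀ᶠ u in 𝓝 t, Φ.IsLiftAt γ c u) ∧ (∀ᶠ u in 𝓝 t, Φ.IsLiftAt γ c₀ u) ∧
      c₀ t = T.τ.symm (γ t, Γ.one (Γ.t (T.τ p).2)) ∧
      ∀ᶠ u in 𝓝 t, Γ.t (T.τ (c u)).2 = Γ.t (T.τ (c₀ u)).2 := by
  obtain ⟨ε, hε, N, hN, H⟩ := exists_isLiftAt_nhds (Φ := Φ) hJ hγ ht hT (Γ.one (Γ.t (T.τ p).2))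
  have ht' : t ∈ Ioo (t - ε) (t + ε) := ⟨by linarith, by linarith⟩
  obtain ⟨c, hct, hc⟩ := H t ht' _ (mem_of_mem_nhds hN)
  have hμ : ∀ u ∈ Ioo (t - ε) (t + ε), 𝓑.μ (c u) = Γ.t (T.τ p).2 := by
    intro u hu
    rw [moment_eq_of_isLiftAt isOpen_Ioo ordConnected_Ioo hc ht' hu, hct, (T.map_symm hT _).2.2,
      Γ.s_one]
  have hI : Ioo (t - ε) (t + ε) ∈ 𝓝 t := isOpen_Ioo.mem_nhds ht'
  have hO : ∀ᶠ u in 𝓝 t, γ u ∈ T.O :=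
    (hγ.continuousOn.continuousAt (hJ.mem_nhds ht)).eventually_mem (T.isOpen_O.mem_nhds hT)
  refine ⟨fun u => 𝓑.act (c u) (T.τ p).2, c, ?_, ?_, mem_of_superset hI hc, hct, ?_⟩
  · simp only [hct, ← hp]
    exact T.act_symm_one (by rw [hp]; exact hT)
  · filter_upwards [hI] with u hu
    exact (hc u hu).act (mem_of_superset (isOpen_Ioo.mem_nhds hu) hμ)
  · filter_upwards [hI, hO] with u hu hOu
    have h1 : 𝓑.proj (c u) ∈ T.O := by rw [(hc u hu).2.1]; exact hOu
    -- Right translation does not change the shadow: t(h.g) = t(h).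
    rw [T.act_apply _ _ h1 (hμ u hu), Γ.t_mul _ _ (by rw [T.s_apply _ h1, hμ u hu])]

variable (Φ) in
/-- The right-hand side of the differential equation for the `M`-component of a horizontal lift of
`γ` to the shadow bundle in a bundle chart. -/
def shadowField (T : 𝓑.Triv) (b : B) (m : M) (γ : ℝ → B) (q : ℝ × EM) : EM :=
  fderiv ℝ (chartAt EM m ∘ Γ.t ∘ (chartAt EG (Γ.one m)).symm)
    (chartAt EG (Γ.one m) (Γ.one ((chartAt EM m).symm q.2)))
    (Φ.liftField T b (Γ.one m) γ
      (q.1, chartAt EG (Γ.one m) (Γ.one ((chartAt EM m).symm q.2))))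

omit [FiniteDimensional ℝ EB] [FiniteDimensional ℝ EG] [IsManifold 𝓘(ℝ, EP) ∞ P]
  [IsManifold 𝓘(ℝ, EB) ∞ B] in
theorem contDiffAt_target_in_charts {m : M} {g : G} {y : EG} (hy : y ∈ (chartAt EG g).target)
    (hm : Γ.t ((chartAt EG g).symm y) ∈ (chartAt EM m).source) :
    ContDiffAt ℝ ∞ (chartAt EM m ∘ Γ.t ∘ (chartAt EG g).symm) y := by
  refine contMDiffAt_iff_contDiffAt.1 ?_
  exact (contMDiffAt_of_mem_maximalAtlas (IsManifold.chart_mem_maximalAtlas m) hm).comp y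
    (Γ.submersion_t.contMDiff.contMDiffAt.comp y
      (contMDiffOn_chart_symm.contMDiffAt ((chartAt EG g).open_target.mem_nhds hy)))

omit [FiniteDimensional ℝ EG] in
-- The shadow field is T t applied to the lift field along the units, a composite of smooth maps;
-- this regularity is what uniqueness of shadow lifts needs.
theorem contDiffAt_shadowField {J : Set ℝ} (hJ : IsOpen J)
    (hγ : ContMDiffOn 𝓘(ℝ, ℝ) 𝓘(ℝ, EB) ∞ γ J) (ht : t ∈ J) {T : 𝓑.Triv} (hT : γ t ∈ T.O) {b : B}
    (hb : γ t ∈ (chartAt EB b).source) (m : M) :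
    ContDiffAt ℝ ∞ (Φ.shadowField T b m γ) (t, chartAt EM m m) := by
  have hm : (chartAt EM m).symm (chartAt EM m m) = m := (chartAt EM m).left_inv (mem_chart_source _ _)
  have h1 : ContDiffAt ℝ ∞ (fun q : ℝ × EM =>
      chartAt EG (Γ.one m) (Γ.one ((chartAt EM m).symm q.2))) (t, chartAt EM m m) := by
    have : ContMDiffAt 𝓘(ℝ, EM) 𝓘(ℝ, EG) ∞
        (chartAt EG (Γ.one m) ∘ Γ.one ∘ (chartAt EM m).symm) (chartAt EM m m) := by
      refine (contMDiffAt_of_mem_maximalAtlas (IsManifold.chart_mem_maximalAtlas (Γ.one m)) ?_).comp _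
        (Γ.smooth_one.contMDiffAt.comp _ (contMDiffOn_chart_symm.contMDiffAt
          ((chartAt EM m).open_target.mem_nhds (mem_chart_target _ _))))
      simp only [Function.comp, hm]
      exact mem_chart_source _ _
    exact ContDiffAt.comp (f := Prod.snd) (g := chartAt EG (Γ.one m) ∘ Γ.one ∘ (chartAt EM m).symm)
      (t, chartAt EM m m) (contMDiffAt_iff_contDiffAt.1 this) contDiffAt_snd
  have h2 : ContDiffAt ℝ ∞ (Φ.liftField T b (Γ.one m) γ)
      (t, chartAt EG (Γ.one m) (Γ.one ((chartAt EM m).symm (chartAt EM m m)))) := by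
    refine (contDiffOn_liftField hJ hγ T b (Γ.one m)).contDiffAt ((IsOpen.prod
      (hγ.continuousOn.isOpen_inter_preimage hJ (T.isOpen_O.inter (chartAt EB b).open_source))
      (chartAt EG (Γ.one m)).open_target).mem_nhds ⟨⟨ht, hT, hb⟩, ?_⟩)
    rw [hm]
    exact mem_chart_target _ _
  have h3 : ContDiffAt ℝ ∞ (fderiv ℝ (chartAt EM m ∘ Γ.t ∘ (chartAt EG (Γ.one m)).symm))
      (chartAt EG (Γ.one m) (Γ.one ((chartAt EM m).symm (chartAt EM m m)))) := by
    rw [hm]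
    refine (contDiffAt_target_in_charts (mem_chart_target _ _) ?_).fderiv_right (m := ∞) le_rfl
    rw [(chartAt EG (Γ.one m)).left_inv (mem_chart_source _ _), Γ.t_one]
    exact mem_chart_source _ _
  have h4 : ContDiffAt ℝ ∞ (fun q : ℝ × EM => Φ.liftField T b (Γ.one m) γ
      (q.1, chartAt EG (Γ.one m) (Γ.one ((chartAt EM m).symm q.2)))) (t, chartAt EM m m) :=
    ContDiffAt.comp (g := Φ.liftField T b (Γ.one m) γ) (f := fun q : ℝ × EM =>
      (q.1, chartAt EG (Γ.one m) (Γ.one ((chartAt EM m).symm q.2)))) (t, chartAt EM m m) h2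
      (contDiffAt_fst.prodMk h1)
  exact (h3.comp (t, chartAt EM m m) h1).clm_apply h4

/-- The differential equation for horizontal lifts to the shadow bundle. -/
theorem hasDerivAt_shadow [T2Space M] {J : Set ℝ} (hJ : IsOpen J)
    (hγ : ContMDiffOn 𝓘(ℝ, ℝ) 𝓘(ℝ, EB) ∞ γ J) (ht : t ∈ J) {f : ℝ → 𝓑.Shadow}
    (hf : ContMDiffAt 𝓘(ℝ, ℝ) (𝓘(ℝ, EB).prod 𝓘(ℝ, EM)) ∞ f t)
    (hfγ : ∀ᶠ u in 𝓝 t, 𝓑.shadowProj (f u) = γ u)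
    (hfh : (⟨f t, mfderiv 𝓘(ℝ, ℝ) (𝓘(ℝ, EB).prod 𝓘(ℝ, EM)) f t (1 : ℝ)⟩ :
      TangentBundle (𝓘(ℝ, EB).prod 𝓘(ℝ, EM)) 𝓑.Shadow) ∈ Φ.shadowHorizontal)
    {T : 𝓑.Triv} (hT : γ t ∈ T.O) {b : B} (hb : γ t ∈ (chartAt EB b).source) {m : M}
    (hm : (𝓑.shadowCore.localTriv T (f t)).2 ∈ (chartAt EM m).source)
    (hm' : Γ.one (𝓑.shadowCore.localTriv T (f t)).2 ∈ (chartAt EG (Γ.one m)).source) :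
    HasDerivAt (fun u => chartAt EM m (𝓑.shadowCore.localTriv T (f u)).2)
      (Φ.shadowField T b m γ (t, chartAt EM m (𝓑.shadowCore.localTriv T (f t)).2)) t := by
  -- The velocity of `f` is the image of a horizontal vector `h` at some `p`, an arbitrary point
  -- with shadow `f t`. Translation to the unit will remove the dependence on `p`.
  obtain ⟨⟨p, h⟩, hh, heq⟩ := hfh
  have hpf : 𝓑.duck p = f t := congrArg TotalSpace.proj heq
  have hpγ : 𝓑.proj p = γ t := (congrArg 𝓑.shadowProj hpf).trans hfγ.self_of_nhds
  have hpO : 𝓑.proj p ∈ T.O := by rw [hpγ]; exact hT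
  have hpb : 𝓑.proj p ∈ (chartAt EB b).source := by rw [hpγ]; exact hb
  have hpm : (𝓑.shadowCore.localTriv T (f t)).2 = Γ.t (T.τ p).2 := by
    rw [← hpf, 𝓑.localTriv_duck T p hpO]
  rw [hpm] at hm hm' ⊢
  obtain ⟨c, c₀, hcp, hc, hc₀, hc₀t, hcc₀⟩ := exists_isLiftAt_translate (Φ := Φ) hJ hγ ht hT hpγ
  subst hcp
  set k : P → EB × EM := fun q => (chartAt EB b (𝓑.proj q), chartAt EM m (Γ.t (T.τ q).2)) with hk
  have hkd : MDifferentiableAt 𝓘(ℝ, EP) 𝓘(ℝ, EB × EM) k (c t) :=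
    (Triv.contMDiffAt_duck_coord hpO hpb hm).mdifferentiableAt (by simp)
  have hs : 𝓑.duck (c t) ∈ (T.shadowCoord b m).source :=
    (Triv.duck_mem_shadowCoord_source hpO).2 ⟨hpb, hm⟩
  have hed : ∀ {x : 𝓑.Shadow}, x ∈ (T.shadowCoord b m).source →
      MDifferentiableAt (𝓘(ℝ, EB).prod 𝓘(ℝ, EM)) 𝓘(ℝ, EB × EM) (T.shadowCoord b m) x := fun hx =>
    (Triv.contMDiffOn_shadowCoord.contMDiffAt
      ((T.shadowCoord b m).open_source.mem_nhds hx)).mdifferentiableAt (by simp)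
  have hd := hasDerivAt_comp_curve (hed (hpf ▸ hs)) (hf.mdifferentiableAt (by simp))
  have e1 := congrArg (fun X : TangentBundle (𝓘(ℝ, EB).prod 𝓘(ℝ, EM)) 𝓑.Shadow =>
    ((tangentMap (𝓘(ℝ, EB).prod 𝓘(ℝ, EM)) 𝓘(ℝ, EB × EM) (T.shadowCoord b m) X).2 : EB × EM)) heq
  have e2 := mfderiv_comp_apply (c t) (hed hs)
    ((𝓑.contMDiffAt_duck (c t)).mdifferentiableAt (by simp)) h
  have e3 : k =ᶠ[𝓝 (c t)] (T.shadowCoord b m ∘ 𝓑.duck) := by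
    filter_upwards [𝓑.submersion_proj.contMDiff.continuous.continuousAt.eventually_mem
      (T.isOpen_O.mem_nhds hpO)] with q hq
    exact (Triv.shadowCoord_duck hq).symm
  have e4 : (mfderiv 𝓘(ℝ, EP) 𝓘(ℝ, EB × EM) k (c t) h : EB × EM) =
      mfderiv (𝓘(ℝ, EB).prod 𝓘(ℝ, EM)) 𝓘(ℝ, EB × EM) (T.shadowCoord b m) (f t)
        (mfderiv 𝓘(ℝ, ℝ) (𝓘(ℝ, EB).prod 𝓘(ℝ, EM)) f t (1 : ℝ)) :=
    ((congrArg (fun L : EP →L[ℝ] EB × EM => L h) e3.mfderiv_eq).trans e2).trans e1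
  rw [← e4] at hd
  have hdc := hasDerivAt_comp_curve hkd hc.self_of_nhds.mdifferentiableAt
  -- Both `h` and the velocity of the lift `c` through `p` are horizontal over the velocity of γ,
  -- hence equal; so `f` and the shadow of `c` have the same velocity at `t`.
  have hfst : (mfderiv 𝓘(ℝ, EP) 𝓘(ℝ, EB × EM) k (c t) h).1 =
      (mfderiv 𝓘(ℝ, EP) 𝓘(ℝ, EB × EM) k (c t)
        (mfderiv 𝓘(ℝ, ℝ) 𝓘(ℝ, EP) c t (1 : ℝ))).1 := by
    have h1 := (hasFDerivAt_fst (𝕜 := ℝ) (E := EB) (F := EM)).comp_hasDerivAt t hd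
    have h2 := (hasFDerivAt_fst (𝕜 := ℝ) (E := EB) (F := EM)).comp_hasDerivAt t hdc
    refine h1.unique (h2.congr_of_eventuallyEq ?_)
    filter_upwards [hfγ, hc] with u hu hcu
    exact congrArg (chartAt EB b) (hu.trans hcu.2.1.symm)
  have hheq : h = mfderiv 𝓘(ℝ, ℝ) 𝓘(ℝ, EP) c t (1 : ℝ) := by
    refine Φ.eq_of_horizontal hh hc.self_of_nhds.2.2 ?_
    rw [hk, Triv.mfderiv_duck_coord_fst hpO hpb hm, Triv.mfderiv_duck_coord_fst hpO hpb hm] at hfst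
    exact (mdifferentiable_chart (I := 𝓘(ℝ, EB)) b).mfderiv_injective hpb hfst
  rw [← hheq] at hdc
  have hc₀s : (T.τ (c₀ t)).2 = Γ.one (Γ.t (T.τ (c t)).2) := by
    rw [hc₀t, (T.map_symm hT _).2.1]
  have hc₀src : c₀ t ∈ (T.coord b (Γ.one m)).source := by
    rw [Triv.mem_coord_source, hc₀.self_of_nhds.2.1, hc₀s]
    exact ⟨hT, hb, hm'⟩
  have hd₀ := hc₀.self_of_nhds.hasDerivAt_coord_snd (hc₀.mono fun u hu => hu.2.1) hc₀src
  rw [hc₀s] at hd₀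
  have hκ : HasFDerivAt (chartAt EM m ∘ Γ.t ∘ (chartAt EG (Γ.one m)).symm)
      (fderiv ℝ (chartAt EM m ∘ Γ.t ∘ (chartAt EG (Γ.one m)).symm)
        (chartAt EG (Γ.one m) (Γ.one (Γ.t (T.τ (c t)).2))))
      (chartAt EG (Γ.one m) (T.τ (c₀ t)).2) := by
    rw [hc₀s]
    refine ((contDiffAt_target_in_charts ((chartAt EG (Γ.one m)).map_source hm')
      ?_).differentiableAt (by simp)).hasFDerivAt
    rw [(chartAt EG (Γ.one m)).left_inv hm', Γ.t_one]
    exact hm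
  have hd₁ := hκ.comp_hasDerivAt t hd₀
  have hd₂ := (hasFDerivAt_snd (𝕜 := ℝ) (E := EB) (F := EM)).comp_hasDerivAt t hdc
  -- The lifts `c` and `c₀` have the same shadow near `t`, so the velocity can be computed from
  -- `c₀`, which starts at a unit.
  have hval := hd₂.unique (hd₁.congr_of_eventuallyEq (by
    filter_upwards [hcc₀, hc₀.self_of_nhds.1.continuousAt.eventually_mem
      ((T.coord b (Γ.one m)).open_source.mem_nhds hc₀src)] with u hu hsu
    simp only [Function.comp, hk, (chartAt EG (Γ.one m)).left_inv (Triv.mem_coord_source.1 hsu).2.2,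
      hu]))
  rw [shadowField, (chartAt EM m).left_inv hm, ← hval]
  exact (hasFDerivAt_snd (𝕜 := ℝ) (E := EB) (F := EM)).comp_hasDerivAt t hd

end ConnectionForm

/-! ### Uniqueness of shadow lifts, and completeness from the shadow -/

namespace ConnectionForm

variable [IsManifold 𝓘(ℝ, EP) ∞ P] {Φ : 𝓑.ConnectionForm} {γ : ℝ → B}
  [IsManifold 𝓘(ℝ, EB) ∞ B] [IsManifold 𝓘(ℝ, EG) ∞ G] [IsManifold 𝓘(ℝ, EM) ∞ M]
  [FiniteDimensional ℝ EB] [FiniteDimensional ℝ EG] [T2Space M]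

/-- Uniqueness of horizontal lifts to the shadow bundle, over curves in the domain of a local
trivialisation. -/
theorem eqOn_of_shadowHorizontal {J I : Set ℝ} (hJ : IsOpen J)
    (hγ : ContMDiffOn 𝓘(ℝ, ℝ) 𝓘(ℝ, EB) ∞ γ J) (hI : IsOpen I) (hIc : I.OrdConnected) (hIJ : I ⊆ J)
    {T : 𝓑.Triv} (hT : ∀ t ∈ I, γ t ∈ T.O) {f₁ f₂ : ℝ → 𝓑.Shadow}
    (h₁ : ∀ t ∈ I, ContMDiffAt 𝓘(ℝ, ℝ) (𝓘(ℝ, EB).prod 𝓘(ℝ, EM)) ∞ f₁ t ∧ 𝓑.shadowProj (f₁ t) = γ t ∧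
      (⟨f₁ t, mfderiv 𝓘(ℝ, ℝ) (𝓘(ℝ, EB).prod 𝓘(ℝ, EM)) f₁ t (1 : ℝ)⟩ :
        TangentBundle (𝓘(ℝ, EB).prod 𝓘(ℝ, EM)) 𝓑.Shadow) ∈ Φ.shadowHorizontal)
    (h₂ : ∀ t ∈ I, ContMDiffAt 𝓘(ℝ, ℝ) (𝓘(ℝ, EB).prod 𝓘(ℝ, EM)) ∞ f₂ t ∧ 𝓑.shadowProj (f₂ t) = γ t ∧
      (⟨f₂ t, mfderiv 𝓘(ℝ, ℝ) (𝓘(ℝ, EB).prod 𝓘(ℝ, EM)) f₂ t (1 : ℝ)⟩ :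
        TangentBundle (𝓘(ℝ, EB).prod 𝓘(ℝ, EM)) 𝓑.Shadow) ∈ Φ.shadowHorizontal)
    {t₀ : ℝ} (ht₀ : t₀ ∈ I) (heq : f₁ t₀ = f₂ t₀) : EqOn f₁ f₂ I := by
  have hsrc : ∀ {f : ℝ → 𝓑.Shadow} {t : ℝ}, t ∈ I → 𝓑.shadowProj (f t) = γ t →
      f t ∈ (𝓑.shadowCore.localTriv T).source := by
    intro f t ht hf
    rw [FiberBundleCore.mem_localTriv_source]
    exact (congrArg (· ∈ T.O) hf).mpr (hT t ht)
  have hcont : ∀ {f : ℝ → 𝓑.Shadow} {t : ℝ}, t ∈ I → 𝓑.shadowProj (f t) = γ t → ContinuousAt f t →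
      ContinuousAt (fun u => (𝓑.shadowCore.localTriv T (f u)).2) t := by
    intro f t ht hf hft
    exact continuousAt_snd.comp (((𝓑.shadowCore.localTriv T).continuousAt (hsrc ht hf)).comp hft)
  -- Only the `M`-components need comparison, since the base components are both γ. Near a time of
  -- agreement they solve the same smooth equation.
  have key : EqOn (fun u => (𝓑.shadowCore.localTriv T (f₁ u)).2)
      (fun u => (𝓑.shadowCore.localTriv T (f₂ u)).2) I := by
    refine eqOn_of_forall_eventuallyEq hI hIc.isPreconnected
      (fun t ht => (hcont ht (h₁ t ht).2.1 (h₁ t ht).1.continuousAt).continuousWithinAt)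
      (fun t ht => (hcont ht (h₂ t ht).2.1 (h₂ t ht).1.continuousAt).continuousWithinAt) ?_ ht₀
      (by simp only [heq])
    intro t ht hmt
    set b := γ t
    set m := (𝓑.shadowCore.localTriv T (f₁ t)).2 with hm
    have hγb : ∀ᶠ u in 𝓝 t, γ u ∈ (chartAt EB b).source :=
      (hγ.continuousOn.continuousAt (hJ.mem_nhds (hIJ ht))).eventually_mem (chart_source_mem_nhds _ _)
    have hder : ∀ f : ℝ → 𝓑.Shadow,
        (∀ t ∈ I, ContMDiffAt 𝓘(ℝ, ℝ) (𝓘(ℝ, EB).prod 𝓘(ℝ, EM)) ∞ f t ∧ 𝓑.shadowProj (f t) = γ t ∧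
          (⟨f t, mfderiv 𝓘(ℝ, ℝ) (𝓘(ℝ, EB).prod 𝓘(ℝ, EM)) f t (1 : ℝ)⟩ :
            TangentBundle (𝓘(ℝ, EB).prod 𝓘(ℝ, EM)) 𝓑.Shadow) ∈ Φ.shadowHorizontal) →
        (𝓑.shadowCore.localTriv T (f t)).2 = m →
        ∀ᶠ u in 𝓝 t, (𝓑.shadowCore.localTriv T (f u)).2 ∈ (chartAt EM m).source ∧
          HasDerivAt (fun u => chartAt EM m (𝓑.shadowCore.localTriv T (f u)).2)
            (Φ.shadowField T b m γ (u, chartAt EM m (𝓑.shadowCore.localTriv T (f u)).2)) u := by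
      intro f h hfm
      have hc := hcont ht (h t ht).2.1 (h t ht).1.continuousAt
      have hs : ∀ᶠ u in 𝓝 t, (𝓑.shadowCore.localTriv T (f u)).2 ∈ (chartAt EM m).source :=
        hc.eventually_mem (by rw [hfm]; exact chart_source_mem_nhds _ _)
      have hs' : ∀ᶠ u in 𝓝 t, Γ.one (𝓑.shadowCore.localTriv T (f u)).2 ∈
          (chartAt EG (Γ.one m)).source :=
        (Γ.smooth_one.continuous.continuousAt.comp hc).eventually_mem
          (by rw [Function.comp, hfm]; exact chart_source_mem_nhds _ _)
      filter_upwards [hs, hs', hγb, hI.eventually_mem ht] with u hu hu' hub huI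
      exact ⟨hu, hasDerivAt_shadow hJ hγ (hIJ huI) (h u huI).1
        (mem_of_superset (hI.mem_nhds huI) fun v hv => (h v hv).2.1) (h u huI).2.2 (hT u huI) hub
        hu hu'⟩
    have k₁ := hder f₁ h₁ rfl
    have k₂ := hder f₂ h₂ hmt.symm
    have hev := eventuallyEq_of_hasDerivAt
      (y₁ := fun u => chartAt EM m (𝓑.shadowCore.localTriv T (f₁ u)).2)
      (y₂ := fun u => chartAt EM m (𝓑.shadowCore.localTriv T (f₂ u)).2)
      ((contDiffAt_shadowField hJ hγ (hIJ ht) (hT t ht) (mem_chart_source _ _) m).of_le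
        (by exact_mod_cast le_top))
      (k₁.mono fun u hu => hu.2) (k₂.mono fun u hu => hu.2) (congrArg (chartAt EM m) hmt)
    filter_upwards [hev, k₁, k₂] with u hu hu₁ hu₂
    exact (chartAt EM m).injOn hu₁.1 hu₂.1 hu
  intro t ht
  refine (𝓑.shadowCore.localTriv T).toOpenPartialHomeomorph.injOn (hsrc ht (h₁ t ht).2.1)
    (hsrc ht (h₂ t ht).2.1) (Prod.ext ?_ (key ht))
  exact (h₁ t ht).2.1.trans (h₂ t ht).2.1.symm

/-- A connection is complete if the induced shadow connection is complete: horizontal lifts starting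
at units exist for a uniform time, and the groupoid translates them to all points with the same
shadow.  No metric on the groupoid is needed. -/
theorem isComplete_of_shadowIsComplete [T2Space P] (Φ : 𝓑.ConnectionForm)
    (hΦ : Φ.ShadowIsComplete) : Φ.IsComplete := by
  intro J γ hJ hJc hγ t₀ ht₀ p₀ hp₀
  obtain ⟨f, hf, hf₀, hfh⟩ := hΦ J γ hJ hJc hγ t₀ ht₀ (𝓑.duck p₀) hp₀
  refine exists_global_isLiftAt (Q := fun t p => 𝓑.duck p = f t) hJ hJc hγ (fun τ₀ hτ₀ => ?_) ht₀ hp₀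
    hf₀.symm
  obtain ⟨T, hT⟩ : ∃ T : 𝓑.Triv, γ τ₀ ∈ T.O := 𝓑.locally_trivial (γ τ₀)
  -- The time `ε` serves all initial points with shadow in `N`; below, `δ` is chosen so that `f`
  -- stays in `N`.
  obtain ⟨ε, hε, N, hN, H⟩ := exists_isLiftAt_of_shadow_nhds (Φ := Φ) hJ hγ hτ₀ hT
    (𝓑.shadowCore.localTriv T (f τ₀)).2
  have hsrc : f τ₀ ∈ (𝓑.shadowCore.localTriv T).source := by
    rw [FiberBundleCore.mem_localTriv_source]
    exact (congrArg (· ∈ T.O) (hfh τ₀ hτ₀).1).mpr hT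
  have hcont : ContinuousAt (fun u => (𝓑.shadowCore.localTriv T (f u)).2) τ₀ :=
    continuousAt_snd.comp (((𝓑.shadowCore.localTriv T).continuousAt hsrc).comp
      (hf.contMDiffAt (hJ.mem_nhds hτ₀)).continuousAt)
  have hU : (J ∩ γ ⁻¹' T.O) ∩ {u | (𝓑.shadowCore.localTriv T (f u)).2 ∈ N} ∈ 𝓝 τ₀ :=
    inter_mem ((hγ.continuousOn.isOpen_inter_preimage hJ T.isOpen_O).mem_nhds ⟨hτ₀, hT⟩)
      (hcont.preimage_mem_nhds hN)
  obtain ⟨δ, hδ, hδU⟩ := Metric.mem_nhds_iff.1 hU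
  rw [Real.ball_eq_Ioo] at hδU
  set r := min δ ε with hr
  have hr0 : 0 < r := lt_min hδ hε
  have hsub : ∀ a, r ≤ a → Ioo (τ₀ - r) (τ₀ + r) ⊆ Ioo (τ₀ - a) (τ₀ + a) := fun a ha =>
    Ioo_subset_Ioo (by linarith) (by linarith)
  have hrδ := (hsub δ (min_le_left _ _)).trans hδU
  have hrε := hsub ε (min_le_right _ _)
  have hIJ : Ioo (τ₀ - r) (τ₀ + r) ⊆ J := fun t ht => (hrδ ht).1.1
  refine ⟨Ioo (τ₀ - r) (τ₀ + r), isOpen_Ioo, ordConnected_Ioo, ⟨by linarith, by linarith⟩, hIJ,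
    fun τ hτ p hp hpf => ?_⟩
  obtain ⟨c, hcτ, hc⟩ := H τ (hrε hτ) (hrδ hτ).1.2 p hp (by
    have h1 := congrArg Prod.snd (𝓑.localTriv_duck T p (by rw [hp]; exact (hrδ hτ).1.2))
    rw [hpf] at h1
    change Γ.t (T.τ p).2 ∈ N
    rw [← show _ = Γ.t (T.τ p).2 from h1]
    exact (hrδ hτ).2)
  -- The shadow of the new lift is a horizontal lift of γ that meets `f` at time `τ`, so it remains
  -- `f` and the constraint persists.
  have hE : EqOn (𝓑.duck ∘ c) f (Ioo (τ₀ - r) (τ₀ + r)) :=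
    eqOn_of_shadowHorizontal (Φ := Φ) hJ hγ isOpen_Ioo ordConnected_Ioo hIJ
      (fun t ht => (hrδ ht).1.2)
      (fun t ht => ⟨(𝓑.contMDiffAt_duck _).comp t (hc t (hrε ht)).1, (hc t (hrε ht)).2.1,
        (hc t (hrε ht)).duck⟩)
      (fun t ht => ⟨hf.contMDiffAt (hJ.mem_nhds (hIJ ht)), hfh t (hIJ ht)⟩) hτ
      (by rw [Function.comp, hcτ, hpf])
  exact ⟨c, hcτ, fun t ht => ⟨hc t (hrε ht), hE ht⟩⟩

end ConnectionForm

end PrincipaloidBundle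

end

theorem mainTheorem6 {EM EG EB EP M G B P : Type*}
    [NormedAddCommGroup EM] [NormedSpace ℝ EM] [FiniteDimensional ℝ EM]
    [NormedAddCommGroup EG] [NormedSpace ℝ EG] [FiniteDimensional ℝ EG]
    [NormedAddCommGroup EB] [NormedSpace ℝ EB] [FiniteDimensional ℝ EB]
    [NormedAddCommGroup EP] [NormedSpace ℝ EP] [FiniteDimensional ℝ EP]
    [TopologicalSpace M] [ChartedSpace EM M] [IsManifold 𝓘(ℝ, EM) ∞ M]
    [T2Space M] [SecondCountableTopology M]
    [TopologicalSpace G] [ChartedSpace EG G] [IsManifold 𝓘(ℝ, EG) ∞ G]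
    [T2Space G] [SecondCountableTopology G]
    [TopologicalSpace B] [ChartedSpace EB B] [IsManifold 𝓘(ℝ, EB) ∞ B]
    [T2Space B] [SecondCountableTopology B]
    [TopologicalSpace P] [ChartedSpace EP P] [IsManifold 𝓘(ℝ, EP) ∞ P]
    [T2Space P] [SecondCountableTopology P]
    (Γ : LieGroupoid EM EG M G) (𝓑 : PrincipaloidBundle Γ EB EP B P) :
    (∀ Φ : 𝓑.ConnectionForm,
      (∃ η : SmoothMetric EG G, η.IsComplete ∧ Γ.RightInvariantFieldsBounded η) →
        Φ.ShadowIsComplete → Φ.IsComplete) ∧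
    ((∃ η : SmoothMetric EG G, η.IsComplete ∧ Γ.IsInvariantMetric η) → CompactSpace M →
      ∀ Φ : 𝓑.ConnectionForm, Φ.IsComplete) := by
  exact ⟨fun Φ _ hΦ => Φ.isComplete_of_shadowIsComplete hΦ,
    fun _ _ Φ => Φ.isComplete_of_compactSpace⟩
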